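/- Let $p$ be a prime, $n\ge 1$, and let $K/F$ be a Galois extension of fields whose group $G=\langle\sigma\rangle$ is cyclic of order $p^n$. Assume that $F$ contains a primitive $p$th root of unity and, if $p=2$, that either $n>1$ or $-1\in N_{K/F}(K^\times)$. Notation. Let $J=K^\times/K^{\times p}$, an $\mathbb{F}_p[G]$-module written additively (elements of $\mathbb{F}_p[G]$ are also written as exponents), and let $[\gamma]$ be the class of $\gamma\in K^\times$; write $[f]_F$ for the class of $f$ in $F^\times/F^{\times p}$. For $0\le i\le n$ let $K_i$ be the intermediate field with $[K_i:F]=p^i$ and $H_i=\mathrm{Gal}(K/K_i)$; put $K_{-\infty}^\times=\{1\}$ and $p^{-\infty}=0$. For a subgroup $A\subset K^\times$ let $[A]=AK^{\times p}/K^{\times p}\subset J$. Let $m=i(K/F)$ be the least $i\in\{-\infty,0,1,\dots,n\}$ for which there is $\delta\in K^\times$ with $[N_{K/F}(\delta)]_F\ne[1]_F$ and $[\delta]^{\tau-1}\in[K_i^\times]$ for all $\tau\in G$. An element $\delta\in K^\times$ is exceptional if it has these two properties for $i=m$. Let $$e_i=\dim_{\mathbb{F}_p}\left([N_{K_i/F}(K_i^\times)]/[N_{K_{i+1}/F}(K_{i+1}^\times)]\right)\quad(0\le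 i<n),\qquad e_n=\dim_{\mathbb{F}_p}[N_{K/F}(K^\times)].$$ Let $\delta$ be any exceptional element of $K/F$ and let $X\subset J$ be the cyclic $\mathbb{F}_p[G]$-submodule generated by $[\delta]$. Then there are $\mathbb{F}_p[G]$-submodules $Y_0,\dots,Y_n$ of $J$ such that $$J=X\oplus Y,\qquad Y=Y_n\oplus Y_{n-1}\oplus\dots\oplus Y_0,$$ where 1. $\dim_{\mathbb{F}_p}X=p^m+1$; 2. each $Y_i$ is a direct sum of cyclic $\mathbb{F}_p[G]$-modules of dimension $p^i$; 3. for $0\le i\le n-1$, $[K_i^\times]=X^{(\sigma-1)}\oplus Y^{H_i}$ if $m\le i$, and $[K_i^\times]=X^{(\sigma-1)(\sigma^{p^i}-1)^{p^{m-i}-1}}\oplus Y^{H_i}$ if $i<m$ (here $X^{r}$ is the image of $X$ under $r$, and $Y^{H_i}$ the submodule of $Y$ fixed by $H_i$). Moreover, for every such decomposition the following hold. For each $m<i\le n$, $$[N_{K_i/F}(K_i^\times)]=(Y_i+Y_{i+1}+\dots+Y_n)^G,$$ and, if $m\ge 0$, for each $0\le i\le m$, $$[N_{K_i/F}(K_i^\times)]=(X+Y_i+Y_{i+1}+\dots+Y_n)^G.$$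 For each $0\le i\le n$, $H_i$ acts trivially on $Y_i$ and $Y_i$ is a free $\mathbb{F}_p[G/H_i]$-module. For $i\ne m$, $$\operatorname{rank}_{\mathbb{F}_p[G/H_i]}Y_i=e_i,$$ while, if $m\ge 0$, $$1+\operatorname{rank}_{\mathbb{F}_p[G/H_m]}Y_m=e_m.$$ Dimensions and ranks are cardinal numbers and may be infinite. -/

import Mathlib

noncomputable section

namespace PthPower

universe u v

section Classes

variable (p : ℕ)

/-- The group `J(K) = Kˣ / (Kˣ)^p` of `p`th-power classes of `K`, written additively. -/
def J (K : Type v) [Field K] : Type v :=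
  Additive (Kˣ ⧸ (powMonoidHom p : Kˣ →* Kˣ).range)

instance (K : Type v) [Field K] : AddCommGroup (J p K) :=
  inferInstanceAs (AddCommGroup (Additive (Kˣ ⧸ (powMonoidHom p : Kˣ →* Kˣ).range)))

variable {K : Type v} [Field K]

/-- The class map `γ ↦ [γ]`, as a homomorphism from `Kˣ` (written additively) to `J(K)`. -/
def clsHom : Additive Kˣ →+ J p K :=
  MonoidHom.toAdditive (QuotientGroup.mk' (powMonoidHom p : Kˣ →* Kˣ).range)

/-- The class `[γ]` of `γ ∈ Kˣ` in `J(K)`. -/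
def cls (γ : Kˣ) : J p K := clsHom p (Additive.ofMul γ)

theorem cls_surjective (x : J p K) : ∃ γ : Kˣ, cls p γ = x := by
  obtain ⟨γ, hγ⟩ := QuotientGroup.mk_surjective (Additive.toMul x)
  exact ⟨γ, hγ⟩

theorem cls_mul (a b : Kˣ) : cls p (a * b) = cls p a + cls p b :=
  map_add (clsHom p) (Additive.ofMul a) (Additive.ofMul b)

theorem cls_eq_zero_iff (a : Kˣ) : cls p a = 0 ↔ ∃ b : Kˣ, b ^ p = a :=
  QuotientGroup.eq_one_iff (N := (powMonoidHom p : Kˣ →* Kˣ).range) a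

theorem p_nsmul_eq_zero (x : J p K) : p • x = 0 := by
  obtain ⟨γ, rfl⟩ := cls_surjective p x
  have h : p • cls p γ = cls p (γ ^ p) :=
    (map_nsmul (clsHom p) p (Additive.ofMul γ)).symm
  rw [h, cls_eq_zero_iff]
  exact ⟨γ, rfl⟩

instance : Module (ZMod p) (J p K) := AddCommGroup.zmodModule (p_nsmul_eq_zero p)

/-- The image `[A]` in `J(K)` of the range of a homomorphism `A → Kˣ`, as an `𝔽_p`-subspace. -/
def classes {A : Type*} [Group A] (f : A →* Kˣ) : Submodule (ZMod p) (J p K) :=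
  AddSubgroup.toZModSubmodule p ((clsHom p).comp (MonoidHom.toAdditive f)).range

theorem mem_classes {A : Type*} [Group A] (f : A →* Kˣ) (x : J p K) :
    x ∈ classes p f ↔ ∃ a : A, cls p (f a) = x := by
  constructor
  · rintro ⟨a, rfl⟩
    exact ⟨a.toMul, rfl⟩
  · rintro ⟨a, rfl⟩
    exact ⟨Additive.ofMul a, rfl⟩

end Classes

section Action

variable (p : ℕ) {F : Type u} {K : Type v} [Field F] [Field K] [Algebra F K]

/-- The action of a single `τ ∈ Gal(K/F)` on `J(K)`: `[γ] ↦ [τ γ]`. -/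
def galMap (τ : K ≃ₐ[F] K) : J p K →+ J p K :=
  MonoidHom.toAdditive
    (QuotientGroup.map _ (powMonoidHom p : Kˣ →* Kˣ).range (Units.map (τ : K →* K)) (by
      rintro _ ⟨γ, rfl⟩
      exact ⟨Units.map (τ : K →* K) γ, by simp⟩))

theorem galMap_cls (τ : K ≃ₐ[F] K) (γ : Kˣ) :
    galMap p τ (cls p γ) = cls p (Units.map (τ : K →* K) γ) := rfl

/-- The representation of `Gal(K/F)` on the `𝔽_p`-space `J(K)`. -/
def galRep : Representation (ZMod p) (K ≃ₐ[F] K) (J p K) where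
  toFun τ := AddMonoidHom.toZModLinearMap p (galMap p τ)
  map_one' := by
    ext x
    obtain ⟨γ, rfl⟩ := cls_surjective p x
    change galMap p 1 (cls p γ) = cls p γ
    rw [galMap_cls]
    congr 1
  map_mul' τ τ' := by
    ext x
    obtain ⟨γ, rfl⟩ := cls_surjective p x
    change galMap p (τ * τ') (cls p γ) = galMap p τ (galMap p τ' (cls p γ))
    rw [galMap_cls, galMap_cls, galMap_cls]
    congr 1

theorem galRep_cls (τ : K ≃ₐ[F] K) (γ : Kˣ) :
    galRep p τ (cls p γ) = cls p (Units.map (τ : K →* K) γ) := rfl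

/-- `J(K)` as a module over the group algebra `𝔽_p[Gal(K/F)]`. -/
instance : Module (MonoidAlgebra (ZMod p) (K ≃ₐ[F] K)) (J p K) :=
  Module.compHom (J p K) (galRep (F := F) (K := K) p).asAlgebraHom.toRingHom

theorem algebra_smul_def (r : MonoidAlgebra (ZMod p) (K ≃ₐ[F] K)) (x : J p K) :
    r • x = (galRep (F := F) (K := K) p).asAlgebraHom r x := rfl

theorem of_smul (τ : K ≃ₐ[F] K) (x : J p K) :
    MonoidAlgebra.of (ZMod p) (K ≃ₐ[F] K) τ • x = galRep p τ x := by
  rw [algebra_smul_def, Representation.asAlgebraHom_of]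

instance : IsScalarTower (ZMod p) (MonoidAlgebra (ZMod p) (K ≃ₐ[F] K)) (J p K) where
  smul_assoc c r x := by
    rw [algebra_smul_def, algebra_smul_def, map_smul, LinearMap.smul_apply]

/-- `W^H`: the elements of the `𝔽_p[G]`-submodule `W` of `J(K)` fixed by the subgroup `H`. -/
def fixedPart (H : Subgroup (K ≃ₐ[F] K))
    (W : Submodule (MonoidAlgebra (ZMod p) (K ≃ₐ[F] K)) (J p K)) :
    Submodule (ZMod p) (J p K) where
  carrier := {x | x ∈ W ∧ ∀ τ ∈ H, galRep p τ x = x}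
  zero_mem' := ⟨W.zero_mem, fun _ _ => map_zero _⟩
  add_mem' := fun ha hb =>
    ⟨W.add_mem ha.1 hb.1, fun τ hτ => by rw [map_add, ha.2 τ hτ, hb.2 τ hτ]⟩
  smul_mem' := fun c _ hx =>
    ⟨W.smul_of_tower_mem c hx.1, fun τ hτ => by rw [map_smul, hx.2 τ hτ]⟩

/-- `W` is a direct sum of cyclic `𝔽_p[G]`-submodules, each of dimension `d` over `𝔽_p`. -/
def IsSumOfCyclics (d : ℕ)
    (W : Submodule (MonoidAlgebra (ZMod p) (K ≃ₐ[F] K)) (J p K)) : Prop :=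
  ∃ S : Set (Submodule (MonoidAlgebra (ZMod p) (K ≃ₐ[F] K)) (J p K)),
    sSupIndep S ∧ sSup S = W ∧
      ∀ C ∈ S, (∃ x : J p K, C = Submodule.span _ {x}) ∧ Module.finrank (ZMod p) C = d

/-- If the normal subgroup `H` acts trivially on the `𝔽_p[G]`-submodule `W`, the resulting
action of `G ⧸ H` on `W` by `𝔽_p`-linear maps. -/
def quotientRep (H : Subgroup (K ≃ₐ[F] K)) [H.Normal]
    (W : Submodule (MonoidAlgebra (ZMod p) (K ≃ₐ[F] K)) (J p K))
    (h : ∀ τ ∈ H, ∀ w ∈ W, galRep p τ w = w) :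
    Representation (ZMod p) ((K ≃ₐ[F] K) ⧸ H) W :=
  QuotientGroup.lift H
    ((Algebra.lsmul (ZMod p) (ZMod p) W :
        MonoidAlgebra (ZMod p) (K ≃ₐ[F] K) →ₐ[ZMod p] Module.End (ZMod p) W).toRingHom.toMonoidHom.comp
      (MonoidAlgebra.of (ZMod p) (K ≃ₐ[F] K)))
    (fun τ hτ => by
      ext w
      change MonoidAlgebra.of (ZMod p) (K ≃ₐ[F] K) τ • (w : J p K) = w
      rw [of_smul]
      exact h τ hτ w w.2)

theorem quotientRep_mk (H : Subgroup (K ≃ₐ[F] K)) [H.Normal]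
    (W : Submodule (MonoidAlgebra (ZMod p) (K ≃ₐ[F] K)) (J p K))
    (h : ∀ τ ∈ H, ∀ w ∈ W, galRep p τ w = w) (τ : K ≃ₐ[F] K) (w : W) :
    (quotientRep p H W h (QuotientGroup.mk τ) w : J p K) = galRep p τ w :=
  of_smul p τ (w : J p K)

/-- The `𝔽_p[G ⧸ H]`-module structure on an `𝔽_p[G]`-submodule on which `H` acts trivially. -/
@[reducible]
def quotientModule (H : Subgroup (K ≃ₐ[F] K)) [H.Normal]
    (W : Submodule (MonoidAlgebra (ZMod p) (K ≃ₐ[F] K)) (J p K))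
    (h : ∀ τ ∈ H, ∀ w ∈ W, galRep p τ w = w) :
    Module (MonoidAlgebra (ZMod p) ((K ≃ₐ[F] K) ⧸ H)) W :=
  Module.compHom W (quotientRep p H W h).asAlgebraHom.toRingHom

/-- `H` is normal and acts trivially on `W`, and `W` is a free `𝔽_p[G ⧸ H]`-module of rank `c`
(a cardinal, since ranks may be infinite). -/
def HasFreeRank (H : Subgroup (K ≃ₐ[F] K))
    (W : Submodule (MonoidAlgebra (ZMod p) (K ≃ₐ[F] K)) (J p K)) (c : Cardinal.{v}) : Prop :=
  ∃ (_ : H.Normal) (h : ∀ τ ∈ H, ∀ w ∈ W, galRep p τ w = w),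
    letI := quotientModule p H W h
    Module.Free (MonoidAlgebra (ZMod p) ((K ≃ₐ[F] K) ⧸ H)) W ∧
      Module.rank (MonoidAlgebra (ZMod p) ((K ≃ₐ[F] K) ⧸ H)) W = c

end Action

section Tower

variable (p n : ℕ) {F : Type u} {K : Type v} [Field F] [Field K] [Algebra F K]
  (σ : K ≃ₐ[F] K)

/-- `H_i = ⟨σ^(p^i)⟩`, the subgroup of index `p^i` in `G = ⟨σ⟩`. -/
def layerGroup (i : ℕ) : Subgroup (K ≃ₐ[F] K) := Subgroup.zpowers (σ ^ p ^ i)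

/-- `K_i`, the fixed field of `H_i`. -/
def layer (i : ℕ) : IntermediateField F K :=
  IntermediateField.fixedField (layerGroup p σ i)

theorem fixingSubgroup_layer [FiniteDimensional F K] (i : ℕ) :
    (layer p σ i).fixingSubgroup = layerGroup p σ i :=
  IntermediateField.fixingSubgroup_fixedField _

theorem finrank_layer [FiniteDimensional F K] [IsGalois F K] [Fact p.Prime]
    (hσ : ∀ τ : K ≃ₐ[F] K, τ ∈ Subgroup.zpowers σ) (hcard : Nat.card (K ≃ₐ[F] K) = p ^ n)
    (i : ℕ) (hi : i ≤ n) : Module.finrank F (layer p σ i) = p ^ i := by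
  have hp : 0 < p := (Fact.out : p.Prime).pos
  have ho : orderOf σ = p ^ n := by
    rw [← hcard]; exact orderOf_eq_card_of_forall_mem_zpowers hσ
  have h1 : Module.finrank (layer p σ i) K = p ^ (n - i) := by
    rw [layer, IntermediateField.finrank_fixedField_eq_card, layerGroup, Nat.card_zpowers,
      orderOf_pow, ho, Nat.gcd_eq_right (pow_dvd_pow p hi), Nat.pow_div hi hp]
  have h2 := Module.finrank_mul_finrank F (layer p σ i) K
  rw [h1, ← IsGalois.card_aut_eq_finrank F K, hcard, ← Nat.add_sub_cancel' hi, pow_add] at h2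
  simpa [hp.ne'] using h2

/-- `[K_iˣ] ⊆ J(K)`. -/
def layerClasses (i : ℕ) : Submodule (ZMod p) (J p K) :=
  classes p (Units.map ((layer p σ i).val : layer p σ i →* K))

/-- `[K_iˣ]` for `i ∈ {-∞} ∪ ℕ`, where `K_{-∞}ˣ = {1}`. -/
def layerClassesBot (i : WithBot ℕ) : Submodule (ZMod p) (J p K) :=
  WithBot.recBotCoe (C := fun _ => Submodule (ZMod p) (J p K)) ⊥ (layerClasses p σ) i

/-- `[N_{K_i/F}(K_iˣ)] ⊆ J(K)`. -/
def normClasses (i : ℕ) : Submodule (ZMod p) (J p K) :=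
  classes p ((Units.map (algebraMap F K : F →* K)).comp
    (Units.map (Algebra.norm F : layer p σ i →* F)))

/-- `e_i = dim [N_{K_i/F}(K_iˣ)] / [N_{K_{i+1}/F}(K_{i+1}ˣ)]` for `i < n`, and
`e_n = dim [N_{K_n/F}(K_nˣ)]`, where `K_n = K`. -/
def normDim (i : ℕ) : Cardinal.{v} :=
  if i < n then
    Module.rank (ZMod p)
      (normClasses p σ i ⧸ (normClasses p σ (i + 1)).submoduleOf (normClasses p σ i))
  else Module.rank (ZMod p) (normClasses p σ n)

/-- `p^m` for `m ∈ {-∞} ∪ ℕ`, where `p^(-∞) = 0`. -/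
def powBot (m : WithBot ℕ) : ℕ := WithBot.recBotCoe (C := fun _ => ℕ) 0 (fun k => p ^ k) m

/-- `[N_{K/F}(δ)]_F ≠ [1]_F`, and `[δ]^(τ-1) ∈ [K_iˣ]` for all `τ ∈ Gal(K/F)`. -/
def IsExceptionalAt (i : WithBot ℕ) (δ : Kˣ) : Prop :=
  cls p (Units.map (Algebra.norm F : K →* F) δ) ≠ cls p (1 : Fˣ) ∧
    ∀ τ : K ≃ₐ[F] K, galRep p τ (cls p δ) - cls p δ ∈ layerClassesBot p σ i

/-- The set of `i ∈ {-∞, 0, …, n}` whose minimum is `i(K/F)`. -/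
def exceptionalIndices : Set (WithBot ℕ) :=
  {i | i ≤ (n : WithBot ℕ) ∧ ∃ δ : Kˣ, IsExceptionalAt p σ i δ}

/-- The cyclic `𝔽_p[G]`-submodule `X` of `J(K)` generated by `[δ]`. -/
def cyclicPart (F : Type u) [Field F] [Algebra F K] (δ : Kˣ) :
    Submodule (MonoidAlgebra (ZMod p) (K ≃ₐ[F] K)) (J p K) :=
  Submodule.span _ {cls p δ}

/-- The family `Y_0, …, Y_n` is a decomposition `J = X ⊕ Y`, `Y = Y_n ⊕ ⋯ ⊕ Y_0`, where `X` is
generated by `[δ]` and `m ∈ {-∞} ∪ ℕ`. The sums in `layer_eq_of_le` and `layer_eq_of_lt` are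
direct because `X ∩ Y = 0`. -/
structure IsDecomposition (m : WithBot ℕ) (δ : Kˣ)
    (Y : Fin (n + 1) → Submodule (MonoidAlgebra (ZMod p) (K ≃ₐ[F] K)) (J p K)) : Prop where
  isCompl : IsCompl (cyclicPart p F δ) (⨆ i, Y i)
  indep : iSupIndep Y
  finrank_cyclicPart : Module.finrank (ZMod p) (cyclicPart p F δ) = powBot p m + 1
  isSumOfCyclics : ∀ i : Fin (n + 1), IsSumOfCyclics p (p ^ (i : ℕ)) (Y i)
  layer_eq_of_le : ∀ i : ℕ, i < n → m ≤ (i : WithBot ℕ) →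
    layerClasses p σ i =
      Submodule.map (galRep p σ - 1) ((cyclicPart p F δ).restrictScalars (ZMod p)) ⊔
        fixedPart p (layerGroup p σ i) (⨆ j, Y j)
  layer_eq_of_lt : ∀ i k : ℕ, i < n → m = (k : WithBot ℕ) → i < k →
    layerClasses p σ i =
      Submodule.map ((galRep p σ - 1) * (galRep p (σ ^ p ^ i) - 1) ^ (p ^ (k - i) - 1))
          ((cyclicPart p F δ).restrictScalars (ZMod p)) ⊔
        fixedPart p (layerGroup p σ i) (⨆ j, Y j)

end Tower

end PthPower

end

/-! Put t = σ - 1. The ring 𝔽_p[G] is generated by t, and t^(p^n) = 0. Furthermore t^(p^i) = σ^(p^i)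
- 1 detects the vectors fixed by H_i, t^(p^i - 1) is the norm element of K_i/F, and t^(p^j - p^i)
acts on U_j = [K_jˣ] as the norm from K_j to K_i. The norm classes N_i = t^(p^i - 1) U_i form a
descending chain of spaces killed by t, and a direct sum of cyclic modules is governed by its socle,
the elements killed by t.

Arithmetic enters through two facts. By Hilbert 90 and Kummer theory
(`exists_eq_add_of_augGen_pow_smul_eq_zero`), an element of U_{i+1} with zero norm class lies in U_i
+ tU_{i+1}, up to a multiple of t^(p^n - p^(i+1))[δ] that matters only for i + 1 = n. By minimality
of m (`socle_notMem_of_isLeast`), the socle generator t^(p^m)[δ] of X lies in N_i exactly when i ≤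
m.

Existence (`exists_decomposition`): choose a complement D_i in N_i of N_{i+1}, enlarged by the socle
of X when i ≤ m. Lift a basis of D_i through t^(p^i - 1) to U_i and let the lifts generate Y_i.
Independent socles make the cyclic modules independent. They generate because any element of U_i can
be corrected to have norm class zero; the kernel fact, induction on i and nilpotence of t then
finish.

Conversely, condition 3 says that for i < n the space U_i is the part of tX ⊕ Y killed by t^(p^i).
Applying t^(p^i - 1) computes every N_i (`mem_normImage_iff`). Hence N_i/N_{i+1} is the socle of
Y_i, together with the socle line of X when i = m, and the dimension of a socle counts cyclic
summands, that is, the free rank.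

The index μ stands for m + 1, with μ = 0 for m = -∞, so that `shiftedPow p μ` is p^m and μ ≤ i means
m < i. -/

namespace PthPower

universe u v

/-! ### Modules over an algebra generated by one nilpotent element -/

section NilpotentGenerator

variable {k A V : Type*} [Field k] [Ring A] [Algebra k A] [AddCommGroup V] [Module A V] {t : A}

theorem exists_eq_algebraMap_add_mul (ht : Algebra.adjoin k {t} = ⊤) (a : A) :
    ∃ (r : k) (b : A), a = algebraMap k A r + b * t := by
  have ha : a ∈ Algebra.adjoin k {t} := by rw [ht]; trivial
  rw [Algebra.adjoin_singleton_eq_range_aeval] at ha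
  obtain ⟨f, rfl⟩ := ha
  refine ⟨f.coeff 0, Polynomial.aeval t f.divX, ?_⟩
  conv_lhs => rw [← Polynomial.divX_mul_X_add f]
  simp [add_comm]

theorem commute_generator (ht : Algebra.adjoin k {t} = ⊤) (a : A) : Commute a t := by
  have ha : a ∈ Algebra.adjoin k {t} := by rw [ht]; trivial
  rw [Algebra.adjoin_singleton_eq_range_aeval] at ha
  obtain ⟨f, rfl⟩ := ha
  have h : Polynomial.aeval t (f * Polynomial.X) = Polynomial.aeval t (Polynomial.X * f) := by
    rw [mul_comm]
  simpa [commute_iff_eq] using h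

theorem pow_smul_smul_comm (ht : Algebra.adjoin k {t} = ⊤) (a : A) (j : ℕ) (x : V) :
    t ^ j • a • x = a • t ^ j • x := by
  rw [smul_smul, smul_smul, ((commute_generator ht a).pow_right j).eq]

theorem pow_smul_eq_zero_of_le {l j : ℕ} (h : l ≤ j) {x : V} (hx : t ^ l • x = 0) :
    t ^ j • x = 0 := by
  rw [← Nat.sub_add_cancel h, pow_add, mul_smul, hx, smul_zero]

variable [Module k V] [IsScalarTower k A V]

/-- A `k`-subspace that is stable under a generator of `A` is an `A`-submodule. -/
def stableSubmodule (ht : Algebra.adjoin k {t} = ⊤) (W : Submodule k V)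
    (hW : ∀ x ∈ W, t • x ∈ W) : Submodule A V where
  carrier := W
  zero_mem' := W.zero_mem
  add_mem' := W.add_mem
  smul_mem' a x hx := by
    have ha : a ∈ Algebra.adjoin k {t} := by rw [ht]; trivial
    induction ha using Algebra.adjoin_induction generalizing x with
    | mem y hy => rw [Set.mem_singleton_iff.1 hy]; exact hW x hx
    | algebraMap r => rw [algebraMap_smul]; exact W.smul_mem r hx
    | add a b _ _ iha ihb => rw [add_smul]; exact W.add_mem (iha x hx) (ihb x hx)
    | mul a b _ _ iha ihb => rw [mul_smul]; exact iha _ (ihb x hx)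

/-- The socle of a cyclic module is a line. If z = a t^j c with j < l - 1 and a = r + bt, then
t^(l-1-j) kills z but sends it to r t^(l-1) c, so r = 0 and z is divisible by one more power of t.
-/
theorem exists_smul_of_mem_span_singleton_of_smul_eq_zero (ht : Algebra.adjoin k {t} = ⊤)
    {c : V} {l : ℕ} (hl : 0 < l) (hc : t ^ l • c = 0) (hc' : t ^ (l - 1) • c ≠ 0) {z : V}
    (hz : z ∈ Submodule.span A {c}) (htz : t • z = 0) : ∃ r : k, r • t ^ (l - 1) • c = z := by
  have key : ∀ j ≤ l - 1, ∃ a : A, z = a • t ^ j • c := by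
    intro j
    induction j with
    | zero =>
      intro _
      obtain ⟨a, rfl⟩ := Submodule.mem_span_singleton.1 hz
      exact ⟨a, by simp⟩
    | succ j ih =>
      intro hj
      obtain ⟨a, ha⟩ := ih (by omega)
      obtain ⟨r, b, rfl⟩ := exists_eq_algebraMap_add_mul ht a
      have h1 : t ^ (l - 1 - j) • z = 0 := by
        apply pow_smul_eq_zero_of_le (l := 1) (by omega); simpa using htz
      have h2 : t ^ (l - 1 - j) • z = r • t ^ (l - 1) • c := by
        rw [ha, pow_smul_smul_comm ht, add_smul, mul_smul, smul_smul (t ^ _), ← pow_add,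
          show l - 1 - j + j = l - 1 by omega, smul_smul t, ← pow_succ',
          show l - 1 + 1 = l by omega, hc, smul_zero, add_zero, algebraMap_smul]
      have hr : r = 0 := by
        by_contra hr
        rw [h1] at h2
        exact (smul_ne_zero hr hc') h2.symm
      refine ⟨b, ?_⟩
      rw [ha, hr, map_zero, zero_add, mul_smul, smul_smul t, ← pow_succ']
  obtain ⟨a, ha⟩ := key (l - 1) le_rfl
  obtain ⟨r, b, rfl⟩ := exists_eq_algebraMap_add_mul ht a
  refine ⟨r, ?_⟩
  rw [ha, add_smul, mul_smul, smul_smul t, ← pow_succ', Nat.sub_add_cancel hl, hc, smul_zero,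
    add_zero, algebraMap_smul]

/-- Induction with c replaced by tc: the top power of t kills every later vector but not c itself.
-/
theorem linearIndependent_pow_smul {c : V} {l : ℕ} (hc : t ^ (l + 1) • c = 0)
    (hc' : t ^ l • c ≠ 0) : LinearIndependent k fun j : Fin (l + 1) => t ^ (j : ℕ) • c := by
  induction l generalizing c with
  | zero =>
    have : Subsingleton (Fin (0 + 1)) := inferInstanceAs (Subsingleton (Fin 1))
    rw [linearIndependent_subsingleton_index_iff]
    intro i
    simpa [Fin.fin_one_eq_zero i] using hc'
  | succ l ih =>
    rw [linearIndependent_finSucc]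
    constructor
    · have h := ih (c := t • c) (by rw [smul_smul, ← pow_succ, hc])
        (by rwa [smul_smul, ← pow_succ])
      convert! h using 2 with j
      rw [Fin.tail, Fin.val_succ, smul_smul, ← pow_succ]
    · intro h
      apply hc'
      have hle : Submodule.span k (Set.range (Fin.tail fun j : Fin (l + 1 + 1) => t ^ (j : ℕ) • c))
          ≤ LinearMap.ker (Algebra.lsmul k k V (t ^ (l + 1))) := by
        rw [Submodule.span_le]
        rintro _ ⟨j, rfl⟩
        simp only [SetLike.mem_coe, LinearMap.mem_ker, Algebra.lsmul_coe, Fin.tail, Fin.val_succ]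
        rw [smul_smul, ← pow_add]
        exact pow_smul_eq_zero_of_le (by omega) hc
      simpa only [Algebra.lsmul_coe, Fin.val_zero, pow_zero, one_smul] using
        LinearMap.mem_ker.1 (hle h)

theorem restrictScalars_span_singleton (ht : Algebra.adjoin k {t} = ⊤) {c : V} {l : ℕ}
    (hc : t ^ l • c = 0) : (Submodule.span A {c}).restrictScalars k =
      Submodule.span k (Set.range fun j : Fin l => t ^ (j : ℕ) • c) := by
  apply le_antisymm
  · have hW : ∀ x ∈ Submodule.span k (Set.range fun j : Fin l => t ^ (j : ℕ) • c),
        t • x ∈ Submodule.span k (Set.range fun j : Fin l => t ^ (j : ℕ) • c) := by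
      intro x hx
      induction hx using Submodule.span_induction with
      | mem x hx =>
        obtain ⟨j, rfl⟩ := hx
        simp only [smul_smul, ← pow_succ']
        rcases Nat.lt_or_ge (j + 1) l with h | h
        · exact Submodule.subset_span ⟨⟨j + 1, h⟩, rfl⟩
        · rw [pow_smul_eq_zero_of_le h hc]; exact Submodule.zero_mem _
      | zero => simp
      | add x y _ _ hx hy => rw [smul_add]; exact Submodule.add_mem _ hx hy
      | smul r x _ hx =>
        rw [← algebraMap_smul A r x, ← pow_one t, pow_smul_smul_comm ht, algebraMap_smul, pow_one]
        exact Submodule.smul_mem _ _ hx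
    have hle : Submodule.span A {c} ≤ stableSubmodule ht _ hW := by
      rw [Submodule.span_le, Set.singleton_subset_iff]
      change c ∈ Submodule.span k _
      rcases Nat.eq_zero_or_pos l with rfl | hl
      · have : c = 0 := by simpa using hc
        rw [this]; exact Submodule.zero_mem _
      · exact Submodule.subset_span ⟨⟨0, hl⟩, by simp⟩
    exact fun x hx => hle hx
  · rw [Submodule.span_le]
    rintro _ ⟨j, rfl⟩
    exact Submodule.smul_mem _ _ (Submodule.mem_span_singleton_self c)

theorem finrank_span_singleton_of_pow_smul (ht : Algebra.adjoin k {t} = ⊤) {c : V} {l : ℕ}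
    (hc : t ^ (l + 1) • c = 0) (hc' : t ^ l • c ≠ 0) :
    Module.finrank k (Submodule.span A {c}) = l + 1 := by
  change Module.finrank k ((Submodule.span A {c}).restrictScalars k) = l + 1
  rw [restrictScalars_span_singleton ht hc,
    finrank_span_eq_card (linearIndependent_pow_smul hc hc'), Fintype.card_fin]

/-- Nilpotence provides a least power of t killing c, and that exponent is the dimension. This turns
the dimension conditions on a given decomposition into statements about t. -/
theorem pow_smul_of_finrank_span_singleton (ht : Algebra.adjoin k {t} = ⊤) (hn : IsNilpotent t)
    {c : V} {l : ℕ} (hl : Module.finrank k (Submodule.span A {c}) = l + 1) :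
    t ^ (l + 1) • c = 0 ∧ t ^ l • c ≠ 0 := by
  classical
  have hex : ∃ j, t ^ j • c = 0 := by
    obtain ⟨N, hN⟩ := hn
    exact ⟨N, by rw [hN, zero_smul]⟩
  obtain ⟨j, hj, hj'⟩ : ∃ j, t ^ j • c = 0 ∧ ∀ i < j, t ^ i • c ≠ 0 :=
    ⟨Nat.find hex, Nat.find_spec hex, fun i hi => Nat.find_min hex hi⟩
  rcases j with _ | j
  · have : c = 0 := by simpa using hj
    subst this
    rw [Submodule.span_zero_singleton] at hl
    have h0 : Module.finrank k (⊥ : Submodule A V) = 0 := Module.finrank_zero_of_subsingleton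
    omega
  · have h := finrank_span_singleton_of_pow_smul ht hj (hj' j (by omega))
    obtain rfl : l = j := by omega
    exact ⟨hj, hj' l (by omega)⟩

theorem exists_finset_sum_of_mem_iSup {ι : Type*} {W : ι → Submodule A V} {x : V}
    (hx : x ∈ ⨆ i, W i) : ∃ (s : Finset ι) (f : ι → V), (∀ i, f i ∈ W i) ∧ ∑ i ∈ s, f i = x := by
  classical
  obtain ⟨f, hf⟩ := (Submodule.mem_iSup_iff_exists_dfinsupp' W x).1 hx
  refine ⟨f.support, fun i => f i, fun i => (f i).2, ?_⟩
  rw [← hf]; rfl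

theorem smul_eq_zero_of_smul_sum_eq_zero {ι : Type*} {W : ι → Submodule A V} (hW : iSupIndep W)
    (a : A) {s : Finset ι} {f : ι → V} (hf : ∀ i ∈ s, f i ∈ W i) (h : a • ∑ i ∈ s, f i = 0) :
    ∀ i ∈ s, a • f i = 0 := by
  rw [iSupIndep_iff_finsetSum_eq_zero_imp_eq_zero] at hW
  exact hW s (fun i => a • f i) (fun i hi => (W i).smul_mem a (hf i hi))
    (by rw [← h, Finset.smul_sum])

/-- Induction on a power of t killing all terms: multiplying a relation by t lowers that power, so
every t z_i vanishes. Then each z_i lies in the socle line of its cyclic module, where independence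
is assumed. -/
theorem iSupIndep_span_singleton_of_linearIndependent (ht : Algebra.adjoin k {t} = ⊤)
    (hn : IsNilpotent t) {ι : Type*} {c : ι → V} {l : ι → ℕ} (hl : ∀ i, 0 < l i)
    (hc : ∀ i, t ^ l i • c i = 0) (hli : LinearIndependent k fun i => t ^ (l i - 1) • c i) :
    iSupIndep fun i => Submodule.span A {c i} := by
  rw [iSupIndep_iff_finsetSum_eq_zero_imp_eq_zero]
  intro s z hz h0
  have key : ∀ (N : ℕ) (z : ι → V), (∀ i ∈ s, z i ∈ Submodule.span A {c i}) →
      (∀ i ∈ s, t ^ N • z i = 0) → ∑ i ∈ s, z i = 0 → ∀ i ∈ s, z i = 0 := by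
    intro N
    induction N with
    | zero => intro z _ h _ i hi; simpa using h i hi
    | succ N ih =>
      intro z hz hN h0
      have h1 : ∀ i ∈ s, t • z i = 0 := by
        apply ih _ (fun i hi => Submodule.smul_mem _ _ (hz i hi))
        · intro i hi; rw [smul_smul, ← pow_succ, hN i hi]
        · rw [← Finset.smul_sum, h0, smul_zero]
      have h2 : ∀ i, ∃ r : k, i ∈ s → r • t ^ (l i - 1) • c i = z i := by
        intro i
        by_cases hi : i ∈ s
        · obtain ⟨r, hr⟩ := exists_smul_of_mem_span_singleton_of_smul_eq_zero ht (hl i) (hc i)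
            (hli.ne_zero i) (hz i hi) (h1 i hi)
          exact ⟨r, fun _ => hr⟩
        · exact ⟨0, fun h => absurd h hi⟩
      choose r hr using h2
      rw [Finset.sum_congr rfl fun i hi => (hr i hi).symm] at h0
      intro i hi
      rw [← hr i hi, linearIndependent_iff'.1 hli s r h0 i hi, zero_smul]
  obtain ⟨N, hN⟩ := hn
  exact key N z hz (fun i _ => by rw [hN, zero_smul]) h0

/-- `W` is a free module over `k[t]/(t^l)`, expressed through the kernel and image of `t`. -/
def IsUniform (t : A) (l : ℕ) (W : Submodule A V) : Prop :=
  (∀ w ∈ W, t ^ l • w = 0) ∧ ∀ w ∈ W, t • w = 0 → ∃ w' ∈ W, t ^ (l - 1) • w' = w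

/-- The element t^(a-1) w is in the socle, hence equals t^(l-1) v. Subtracting t^(l-a) v from w
leaves something killed by t^(a-1), to which induction applies. -/
theorem IsUniform.exists_of_pow_smul_eq_zero {l : ℕ} {W : Submodule A V} (h : IsUniform t l W)
    {a : ℕ} (ha : a ≤ l) {w : V} (hw : w ∈ W) (haw : t ^ a • w = 0) :
    ∃ w' ∈ W, t ^ (l - a) • w' = w := by
  induction a generalizing w with
  | zero => exact ⟨0, W.zero_mem, by simpa [eq_comm] using haw⟩
  | succ a ih =>
    obtain ⟨v, hv, hv'⟩ := h.2 (t ^ a • w) (W.smul_mem _ hw) (by rw [smul_smul, ← pow_succ', haw])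
    obtain ⟨u, hu, hu'⟩ := ih (by omega)
      (W.sub_mem hw (W.smul_mem (t ^ (l - (a + 1))) hv)) (by
        rw [smul_sub, smul_smul, ← pow_add, show a + (l - (a + 1)) = l - 1 by omega, hv', sub_self])
    refine ⟨v + t • u, W.add_mem hv (W.smul_mem _ hu), ?_⟩
    rw [smul_add, smul_smul, ← pow_succ, show l - (a + 1) + 1 = l - a by omega, hu']
    abel

theorem isUniform_span_singleton (ht : Algebra.adjoin k {t} = ⊤) {c : V} {l : ℕ}
    (hc : t ^ (l + 1) • c = 0) (hc' : t ^ l • c ≠ 0) :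
    IsUniform t (l + 1) (Submodule.span A {c}) := by
  constructor
  · intro w hw
    obtain ⟨a, rfl⟩ := Submodule.mem_span_singleton.1 hw
    rw [pow_smul_smul_comm ht, hc, smul_zero]
  · intro w hw htw
    obtain ⟨r, hr⟩ := exists_smul_of_mem_span_singleton_of_smul_eq_zero ht (Nat.succ_pos l) hc
      (by simpa using hc') hw htw
    refine ⟨r • c, Submodule.smul_of_tower_mem _ _ (Submodule.mem_span_singleton_self c), ?_⟩
    rw [← hr, ← algebraMap_smul A r c, pow_smul_smul_comm ht, algebraMap_smul]

theorem IsUniform.iSup {ι : Type*} {l : ℕ} {W : ι → Submodule A V} (hW : iSupIndep W)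
    (h : ∀ i, IsUniform t l (W i)) : IsUniform t l (⨆ i, W i) := by
  constructor
  · intro w hw
    obtain ⟨s, f, hf, rfl⟩ := exists_finset_sum_of_mem_iSup hw
    rw [Finset.smul_sum]
    exact Finset.sum_eq_zero fun i _ => (h i).1 _ (hf i)
  · intro w hw htw
    obtain ⟨s, f, hf, rfl⟩ := exists_finset_sum_of_mem_iSup hw
    have h0 := smul_eq_zero_of_smul_sum_eq_zero hW t (fun i _ => hf i) htw
    have h1 : ∀ i, ∃ v ∈ W i, i ∈ s → t ^ (l - 1) • v = f i := by
      intro i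
      by_cases hi : i ∈ s
      · obtain ⟨v, hv, hv'⟩ := (h i).2 _ (hf i) (h0 i hi)
        exact ⟨v, hv, fun _ => hv'⟩
      · exact ⟨0, Submodule.zero_mem _, fun h => absurd h hi⟩
    choose v hv hv' using h1
    refine ⟨∑ i ∈ s, v i, Submodule.sum_mem _ fun i _ => Submodule.mem_iSup_of_mem i (hv i), ?_⟩
    rw [Finset.smul_sum]
    exact Finset.sum_congr rfl fun i hi => hv' i hi

end NilpotentGenerator

/-! ### Independence of families of submodules -/

section Independence

variable {R M : Type*} [Ring R] [AddCommGroup M] [Module R M]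

/-- In a vanishing sum the nonzero term of least κ would lie in the span of the later spaces. -/
theorem iSupIndep_of_disjoint_later {α : Type*} {E : α → Submodule R M} {κ : α → ℕ}
    (hκ : Function.Injective κ)
    (h : ∀ a, Disjoint (E a) (⨆ b, ⨆ (_ : κ a < κ b), E b)) : iSupIndep E := by
  classical
  rw [iSupIndep_iff_finsetSum_eq_zero_imp_eq_zero]
  intro s v hv h0
  have key : ∀ (r : ℕ) (a : α), κ a = r → a ∈ s → v a = 0 := by
    intro r
    induction r using Nat.strong_induction_on with
    | _ r ih =>
      intro a har ha
      have h1 : v a = -∑ b ∈ s.erase a, v b := by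
        rw [← Finset.add_sum_erase s v ha] at h0
        exact eq_neg_of_add_eq_zero_left h0
      refine Submodule.disjoint_def.1 (h a) _ (hv a ha) ?_
      rw [h1]
      refine Submodule.neg_mem _ (Submodule.sum_mem _ fun b hb => ?_)
      obtain ⟨hba, hb⟩ := Finset.mem_erase.1 hb
      rcases lt_trichotomy (κ a) (κ b) with hab | hab | hab
      · exact Submodule.mem_iSup_of_mem b (Submodule.mem_iSup_of_mem hab (hv b hb))
      · exact absurd (hκ hab).symm hba
      · rw [ih (κ b) (har ▸ hab) b rfl hb]; exact Submodule.zero_mem _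
  exact fun a ha => key _ a rfl ha

theorem iSupIndep_iSup_fiber {α : Type*} {β : α → Type*} {Z : (Σ a, β a) → Submodule R M}
    (hZ : iSupIndep Z) : iSupIndep fun a => ⨆ b : β a, Z ⟨a, b⟩ := by
  rw [iSupIndep_def]
  intro a
  have hd : Disjoint {x : Σ a, β a | x.1 = a} {x | x.1 ≠ a} :=
    Set.disjoint_left.2 fun x hx hx' => hx' hx
  refine (hZ.disjoint_biSup_biSup hd).mono ?_ ?_
  · exact iSup_le fun b => le_biSup Z (show (⟨a, b⟩ : Σ a, β a) ∈ {x : Σ a, β a | x.1 = a} from rfl)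
  · exact iSup₂_le fun a' ha' => iSup_le fun b =>
      le_biSup Z (show (⟨a', b⟩ : Σ a, β a) ∈ {x : Σ a, β a | x.1 ≠ a} from ha')

theorem exists_relative_compl {k V : Type*} [Field k] [AddCommGroup V] [Module k V]
    {N N' : Submodule k V} (h : N' ≤ N) : ∃ D, Disjoint D N' ∧ D ⊔ N' = N := by
  obtain ⟨Q, hQ⟩ := exists_isCompl N'
  refine ⟨Q ⊓ N, hQ.disjoint.symm.mono_left inf_le_left, ?_⟩
  rw [sup_comm, ← sup_inf_assoc_of_le Q h, hQ.sup_eq_top, top_inf_eq]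

end Independence

/-! ### Abstract norm filtrations and their socles -/

section Filtration

variable {k A V : Type*} [Field k] [Ring A] [Algebra k A] [AddCommGroup V] [Module A V] {t : A}

/-- Nakayama's lemma for nilpotent t: iterating W ⊆ T + tW gives W ⊆ T + t^N W. -/
theorem le_of_forall_exists_add_smul (hn : IsNilpotent t) {T W : Submodule A V}
    (h : ∀ u ∈ W, ∃ x ∈ T, ∃ w ∈ W, u = x + t • w) : W ≤ T := by
  have key : ∀ (N : ℕ), ∀ u ∈ W, ∃ x ∈ T, ∃ w ∈ W, u = x + t ^ N • w := by
    intro N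
    induction N with
    | zero => exact fun u hu => ⟨0, T.zero_mem, u, hu, by simp⟩
    | succ N ih =>
      intro u hu
      obtain ⟨x, hx, w, hw, rfl⟩ := ih u hu
      obtain ⟨y, hy, v, hv, rfl⟩ := h w hw
      exact ⟨x + t ^ N • y, T.add_mem hx (T.smul_mem _ hy), v, hv, by
        rw [smul_add, smul_smul, pow_succ, add_assoc]⟩
  obtain ⟨N, hN⟩ := hn
  intro u hu
  obtain ⟨x, hx, w, -, rfl⟩ := key N u hu
  rwa [hN, zero_smul, add_zero]

/-- `p ^ (μ - 1)` for `μ > 0`, and `0` for `μ = 0`. -/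
def shiftedPow (p : ℕ) : ℕ → ℕ
  | 0 => 0
  | j + 1 => p ^ j

/-- The properties of the filtration of a module by the classes of the layers of a cyclic tower,
together with an exceptional element `δ`, that determine the module structure. -/
structure NormFiltration (k : Type*) [Field k] [Algebra k A] (t : A) (p n : ℕ)
    (U : ℕ → Submodule A V) (δ : V) (μ : ℕ) : Prop where
  adjoin : Algebra.adjoin k {t} = ⊤
  two_le : 2 ≤ p
  pow_eq_zero : t ^ p ^ n = 0
  mono : Monotone U
  top : U n = ⊤
  pow_smul : ∀ i, ∀ x ∈ U i, t ^ p ^ i • x = 0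
  norm : ∀ i j, i ≤ j → j ≤ n → ∀ x ∈ U j, t ^ (p ^ j - p ^ i) • x ∈ U i
  ker : ∀ i, i + 1 < n → ∀ x ∈ U (i + 1), t ^ (p ^ (i + 1) - 1) • x = 0 →
    ∃ y ∈ U i, ∃ z ∈ U (i + 1), x = y + t • z
  ker_top : ∀ x, t ^ (p ^ n - 1) • x = 0 →
    ∃ y ∈ U (n - 1), ∃ (z : V) (a : A), x = y + t • z + a • δ
  le : μ ≤ n
  pos : 0 < n
  -- Makes the norm of K/F kill X. It fails for p = 2, n = 1, m = 0, which is why that case needs -1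
  -- to be a norm.
  add_two_le : shiftedPow p μ + 2 ≤ p ^ n
  smul_mem : ∀ j, μ ≤ j + 1 → t • δ ∈ U j
  smul_eq_zero : μ = 0 → t • δ = 0
  -- The trace left by the minimality of m: the socle of X is not a norm class from K_μ.
  notMem : ∀ u ∈ U μ, t ^ (p ^ μ - 1) • u ≠ t ^ shiftedPow p μ • δ

namespace NormFiltration

variable {p n : ℕ} {U : ℕ → Submodule A V} {δ : V} {μ : ℕ}

variable (h : NormFiltration k t p n U δ μ)

include h

theorem isNilpotent : IsNilpotent t := ⟨_, h.pow_eq_zero⟩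

theorem one_le_pow (i : ℕ) : 1 ≤ p ^ i := Nat.one_le_pow _ _ (by have := h.two_le; omega)

theorem pow_mono {i j : ℕ} (hij : i ≤ j) : p ^ i ≤ p ^ j :=
  Nat.pow_le_pow_right (by have := h.two_le; omega) hij

theorem pow_smul_generator : t ^ (shiftedPow p μ + 1) • δ = 0 := by
  rcases μ with _ | j
  · simpa [shiftedPow] using h.smul_eq_zero rfl
  · rw [shiftedPow, pow_succ, mul_smul]
    exact h.pow_smul j _ (h.smul_mem j le_rfl)

theorem pow_smul_generator_ne_zero : t ^ shiftedPow p μ • δ ≠ 0 := by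
  intro h0
  exact h.notMem 0 (Submodule.zero_mem _) (by rw [smul_zero, h0])

theorem pow_smul_mem {i : ℕ} (hi : i < μ) : t ^ (shiftedPow p μ + 1 - p ^ i) • δ ∈ U i := by
  obtain ⟨j, rfl⟩ : ∃ j, μ = j + 1 := ⟨μ - 1, by omega⟩
  have h1 := h.pow_mono (show i ≤ j by omega)
  rw [shiftedPow, show p ^ j + 1 - p ^ i = p ^ j - p ^ i + 1 by omega, pow_succ, mul_smul]
  exact h.norm i j (by omega) (by have := h.le; omega) _ (h.smul_mem j le_rfl)

theorem pow_le_shiftedPow {i : ℕ} (hi : i < μ) : p ^ i ≤ shiftedPow p μ := by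
  obtain ⟨j, rfl⟩ : ∃ j, μ = j + 1 := ⟨μ - 1, by omega⟩
  exact h.pow_mono (by omega)

theorem shiftedPow_le_pow {i : ℕ} (hi : μ ≤ i + 1) : shiftedPow p μ ≤ p ^ i := by
  rcases μ with _ | j
  · exact Nat.zero_le _
  · exact h.pow_mono (by omega)

theorem shiftedPow_lt_pow {i : ℕ} (hi : μ ≤ i) : shiftedPow p μ < p ^ i := by
  rcases μ with _ | j
  · exact h.one_le_pow i
  · exact Nat.pow_lt_pow_right h.two_le (by omega)

/-- Components in Y_j with j ≤ i lie in U_i by monotonicity. For j > i a component killed by t^(p^i)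
is t^(p^j - p^i) w with w in Y_j, hence the class of a norm from K_j to K_i. -/
theorem mem_of_isUniform {Y : Fin (n + 1) → Submodule A V} (hind : iSupIndep Y)
    (hY : ∀ j : Fin (n + 1), IsUniform t (p ^ (j : ℕ)) (Y j))
    (hYU : ∀ j : Fin (n + 1), Y j ≤ U j) {i : ℕ} {y : V} (hy : y ∈ ⨆ j, Y j)
    (hi : t ^ p ^ i • y = 0) : y ∈ U i := by
  obtain ⟨s, f, hf, rfl⟩ := exists_finset_sum_of_mem_iSup hy
  have h0 := smul_eq_zero_of_smul_sum_eq_zero hind _ (fun i _ => hf i) hi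
  refine Submodule.sum_mem _ fun j hj => ?_
  rcases Nat.lt_or_ge i j with hij | hij
  · obtain ⟨w, hw, hw'⟩ := (hY j).exists_of_pow_smul_eq_zero (h.pow_mono hij.le) (hf j) (h0 j hj)
    rw [← hw']
    exact h.norm i j hij.le (by omega) w (hYU j hw)
  · exact h.mono hij (hYU j (hf j))

end NormFiltration

variable [Module k V] [IsScalarTower k A V]

/-- The image of `W` under `t ^ (p ^ i - 1)`, which acts as the norm of `K_i / F`. -/
def normImage (k : Type*) [Field k] [Algebra k A] [Module k V] [IsScalarTower k A V]
    (t : A) (p i : ℕ) (W : Submodule A V) : Submodule k V :=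
  (W.restrictScalars k).map (Algebra.lsmul k k V (t ^ (p ^ i - 1)))

theorem mem_normImage {p i : ℕ} {W : Submodule A V} {x : V} :
    x ∈ normImage k t p i W ↔ ∃ w ∈ W, t ^ (p ^ i - 1) • w = x := Iff.rfl

namespace NormFiltration

variable {p n : ℕ} {U : ℕ → Submodule A V} {δ : V} {μ : ℕ}

variable (h : NormFiltration k t p n U δ μ)

include h

/-- Transitivity of norms, as p^(i+1) - 1 = (p^i - 1) + (p^(i+1) - p^i). Beyond n the exponent
reaches p^n and the image is zero, so the chain descends on all of ℕ. -/
theorem normImage_succ_le (i : ℕ) :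
    normImage k t p (i + 1) (U (i + 1)) ≤ normImage k t p i (U i) := by
  intro x hx
  obtain ⟨w, hw, rfl⟩ := mem_normImage.1 hx
  have h1 := h.one_le_pow i
  have h2 := h.pow_mono (Nat.le_succ i)
  rcases Nat.lt_or_ge i n with hi | hi
  · refine mem_normImage.2 ⟨_, h.norm i (i + 1) (by omega) hi w hw, ?_⟩
    rw [smul_smul, ← pow_add]
    congr 2
    simp only [Nat.succ_eq_add_one] at h2
    omega
  · have h3 : p ^ n < p ^ (i + 1) := Nat.pow_lt_pow_right h.two_le (by omega)
    have h4 : t ^ (p ^ (i + 1) - 1) = 0 := by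
      rw [← Nat.sub_add_cancel (show p ^ n ≤ p ^ (i + 1) - 1 by omega), pow_add, h.pow_eq_zero,
        mul_zero]
    rw [h4, zero_smul]
    exact Submodule.zero_mem _

theorem normImage_antitone : Antitone fun i => normImage k t p i (U i) :=
  antitone_nat_of_succ_le h.normImage_succ_le

theorem socle_mem_normImage {i : ℕ} (hi : i < μ) :
    t ^ shiftedPow p μ • δ ∈ normImage k t p i (U i) := by
  refine mem_normImage.2 ⟨_, h.pow_smul_mem hi, ?_⟩
  have h1 := h.one_le_pow i
  have h2 := h.pow_le_shiftedPow hi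
  rw [smul_smul, ← pow_add]
  congr 2
  omega

/-- The D_i are to become the socles of the Y_i. The socle line of X must be left out of them, so it
is added to the next norm space at every index where it occurs. -/
theorem exists_socle_complements : ∃ D : ℕ → Submodule k V,
    (∀ i, D i ⊔ (normImage k t p (i + 1) (U (i + 1)) ⊔
      if i < μ then Submodule.span k {t ^ shiftedPow p μ • δ} else ⊥) = normImage k t p i (U i)) ∧
    iSupIndep fun a : Option (Fin (n + 1)) =>
      Option.elim a (Submodule.span k {t ^ shiftedPow p μ • δ}) fun i => D i := by
  have hle : ∀ i, (normImage k t p (i + 1) (U (i + 1)) ⊔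
      if i < μ then Submodule.span k {t ^ shiftedPow p μ • δ} else ⊥) ≤ normImage k t p i (U i) := by
    intro i
    refine sup_le (h.normImage_succ_le i) ?_
    split_ifs with hi
    · rw [Submodule.span_le, Set.singleton_subset_iff]
      exact h.socle_mem_normImage hi
    · exact bot_le
  choose D hD hD' using fun i => exists_relative_compl (hle i)
  -- The socle line gets position 2μ, between D_{μ-1} and D_μ. Earlier D_i avoid it by construction,
  -- while later ones lie in N_μ, which does not contain it.
  refine ⟨D, hD', iSupIndep_of_disjoint_later
    (κ := fun a => Option.elim a (2 * μ) fun i => 2 * (i : ℕ) + 1) ?_ ?_⟩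
  · rintro (_ | i) (_ | j) hij
    · rfl
    · simp only [Option.elim] at hij; omega
    · simp only [Option.elim] at hij; omega
    · simp only [Option.elim] at hij
      congr 1
      ext
      omega
  · rintro (_ | i)
    · have h1 : Disjoint (Submodule.span k {t ^ shiftedPow p μ • δ}) (normImage k t p μ (U μ)) := by
        rw [disjoint_comm, Submodule.disjoint_span_singleton' h.pow_smul_generator_ne_zero]
        intro hm
        obtain ⟨w, hw, hw'⟩ := mem_normImage.1 hm
        exact h.notMem w hw hw'
      refine h1.mono_right (iSup₂_le ?_)
      rintro (_ | j) hj
      · simp only [Option.elim] at hj; omega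
      · simp only [Option.elim] at hj ⊢
        exact (le_sup_left.trans (hD' j).le).trans (h.normImage_antitone (by omega))
    · refine (hD i).mono_right (iSup₂_le ?_)
      rintro (_ | j) hj
      · simp only [Option.elim] at hj ⊢
        rw [if_pos (show (i : ℕ) < μ by omega)]
        exact le_sup_right
      · simp only [Option.elim] at hj ⊢
        exact ((le_sup_left.trans (hD' j).le).trans (h.normImage_antitone (by omega))).trans
          le_sup_left

end NormFiltration

end Filtration

/-! ### Construction of the decomposition -/

section Existence

variable {k A : Type*} {V : Type u} [Field k] [Ring A] [AddCommGroup V] [Module A V] {t : A}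
  [Module k V]

theorem exists_lift_basis (U : Submodule A V) (D : Submodule k V) (a : A)
    (h : ∀ d ∈ D, ∃ u ∈ U, a • u = d) : ∃ (ι : Type u) (c : ι → V), (∀ i, c i ∈ U) ∧
      LinearIndependent k (fun i => a • c i) ∧ Submodule.span k (Set.range fun i => a • c i) = D := by
  let b := Module.Basis.ofVectorSpace k D
  choose c hc hc' using fun i => h (b i) (b i).2
  refine ⟨_, c, hc, ?_, ?_⟩
  · rw [show (fun i => a • c i) = D.subtype ∘ b from funext hc']
    exact b.linearIndependent.map' D.subtype D.ker_subtype
  · rw [show (fun i => a • c i) = D.subtype ∘ b from funext hc', Set.range_comp,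
      Submodule.span_image, b.span_eq, Submodule.map_subtype_top]

variable [Algebra k A] [IsScalarTower k A V]

namespace NormFiltration

variable {p n : ℕ} {U : ℕ → Submodule A V} {δ : V} {μ : ℕ}
  (h : NormFiltration k t p n U δ μ)

include h

/-- Lifts of bases of the D_i, joined to δ, generate independent cyclic modules because the socle
vectors are linearly independent. -/
theorem exists_generators : ∃ (ι : Fin (n + 1) → Type u) (c : ∀ i, ι i → V),
    (∀ (i : Fin (n + 1)) j, c i j ∈ U i) ∧
    (∀ i : Fin (n + 1), Submodule.span k (Set.range fun j => t ^ (p ^ (i : ℕ) - 1) • c i j) ⊔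
      (normImage k t p (i + 1) (U (i + 1)) ⊔
      if (i : ℕ) < μ then Submodule.span k {t ^ shiftedPow p μ • δ} else ⊥) =
      normImage k t p i (U i)) ∧
    (∀ (i : Fin (n + 1)) j, t ^ (p ^ (i : ℕ) - 1) • c i j ≠ 0) ∧
    iSupIndep fun x : Option (Σ i, ι i) =>
      Submodule.span A {Option.elim x δ fun y => c y.1 y.2} := by
  obtain ⟨D, hD, hind⟩ := h.exists_socle_complements
  have hex : ∀ i : Fin (n + 1), ∀ d ∈ D i, ∃ u ∈ U i, t ^ (p ^ (i : ℕ) - 1) • u = d :=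
    fun i d hd => mem_normImage.1 ((le_sup_left.trans (hD i).le) hd)
  choose ι c hc hli hspan using fun i : Fin (n + 1) => exists_lift_basis (U i) (D i) _ (hex i)
  refine ⟨ι, c, hc, fun i => (by rw [hspan i, hD i]), fun i j => (hli i).ne_zero j, ?_⟩
  refine iSupIndep_span_singleton_of_linearIndependent (k := k) h.adjoin h.isNilpotent
    (l := fun x => Option.elim x (shiftedPow p μ + 1) fun y => p ^ (y.1 : ℕ)) ?_ ?_ ?_
  · rintro (_ | y)
    · exact Nat.succ_pos _
    · exact h.one_le_pow _
  · rintro (_ | y)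
    · exact h.pow_smul_generator
    · exact h.pow_smul _ _ (hc _ _)
  · rw [linearIndependent_option]
    constructor
    · refine linearIndependent_iUnion_finite
        (f := fun (i : Fin (n + 1)) j => t ^ (p ^ (i : ℕ) - 1) • c i j) hli ?_
      intro i s _ his
      simp only [hspan]
      refine (hind (some i)).mono_right (iSup₂_le fun j hj => ?_)
      refine le_iSup₂_of_le (some j) ?_ le_rfl
      rintro hji
      exact his (Option.some_injective _ hji ▸ hj)
    · intro hm
      apply h.pow_smul_generator_ne_zero
      refine Submodule.disjoint_def.1 (hind none) _ (Submodule.mem_span_singleton_self _) ?_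
      refine Submodule.span_le.2 ?_ hm
      rintro _ ⟨⟨i, j⟩, rfl⟩
      refine Submodule.mem_iSup_of_mem (some i) (Submodule.mem_iSup_of_mem (by simp) ?_)
      change _ ∈ D i
      rw [← hspan i]
      exact Submodule.subset_span ⟨j, rfl⟩

section Generators

variable {ι : Fin (n + 1) → Type u} {c : ∀ i, ι i → V} (hc : ∀ (i : Fin (n + 1)) j, c i j ∈ U i)
  (hspan : ∀ i : Fin (n + 1),
    Submodule.span k (Set.range fun j => t ^ (p ^ (i : ℕ) - 1) • c i j) ⊔
      (normImage k t p (i + 1) (U (i + 1)) ⊔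
      if (i : ℕ) < μ then Submodule.span k {t ^ shiftedPow p μ • δ} else ⊥) =
      normImage k t p i (U i))

include hc hspan

/-- Descending induction from N_{n+1} = 0. Only tδ is required in T: for i ≤ m the socle of X is the
norm of t^(p^m + 1 - p^i) δ, whose exponent is positive. -/
theorem normImage_le_of_generators {T : Submodule A V} (hT : t • δ ∈ T)
    (hT' : ∀ i j, c i j ∈ T) {i : ℕ} (hi : i ≤ n) :
    normImage k t p i (U i) ≤ normImage k t p i (U i ⊓ T) := by
  have key : ∀ d i, i + d = n + 1 → normImage k t p i (U i) ≤ normImage k t p i (U i ⊓ T) := by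
    intro d
    induction d with
    | zero =>
      rintro i hi x hx
      obtain ⟨w, hw, rfl⟩ := mem_normImage.1 hx
      have h3 : p ^ n < p ^ i := Nat.pow_lt_pow_right h.two_le (by omega)
      rw [← Nat.sub_add_cancel (show p ^ n ≤ p ^ i - 1 by omega), pow_add, h.pow_eq_zero,
        mul_zero, zero_smul]
      exact Submodule.zero_mem _
    | succ d ih =>
      intro i hi
      rw [← hspan ⟨i, by omega⟩]
      refine sup_le ?_ (sup_le ?_ ?_)
      · rw [Submodule.span_le]
        rintro _ ⟨j, rfl⟩
        exact mem_normImage.2 ⟨_, ⟨hc ⟨i, by omega⟩ j, hT' _ j⟩, rfl⟩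
      · refine (ih (i + 1) (by omega)).trans ?_
        intro x hx
        obtain ⟨w, ⟨hw, hwT⟩, rfl⟩ := mem_normImage.1 hx
        have h1 := h.one_le_pow i
        rcases Nat.eq_zero_or_pos d with rfl | hd
        · have h3 : p ^ n < p ^ (i + 1) := Nat.pow_lt_pow_right h.two_le (by omega)
          rw [← Nat.sub_add_cancel (show p ^ n ≤ p ^ (i + 1) - 1 by omega), pow_add,
            h.pow_eq_zero, mul_zero, zero_smul]
          exact Submodule.zero_mem _
        · have h2 := h.pow_mono (show i ≤ i + 1 by omega)
          refine mem_normImage.2 ⟨_, ⟨h.norm i (i + 1) (by omega) (by omega) w hw,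
            T.smul_mem _ hwT⟩, ?_⟩
          rw [smul_smul, ← pow_add]
          congr 2
          omega
      · split_ifs with hiμ
        · rw [Submodule.span_le, Set.singleton_subset_iff]
          change i < μ at hiμ
          have h1 := h.one_le_pow i
          have h2 := h.pow_le_shiftedPow hiμ
          refine mem_normImage.2 ⟨_, ⟨h.pow_smul_mem hiμ, ?_⟩, ?_⟩
          · rw [show shiftedPow p μ + 1 - p ^ i = shiftedPow p μ - p ^ i + 1 by omega, pow_succ,
              mul_smul]
            exact T.smul_mem _ hT
          · rw [smul_smul, ← pow_add]
            congr 2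
            omega
        · exact bot_le
  exact key (n + 1 - i) i (by omega)

theorem exists_mem_of_generators {T : Submodule A V} (hT : t • δ ∈ T)
    (hT' : ∀ i j, c i j ∈ T) {i : ℕ} (hi : i ≤ n) {u : V} (hu : u ∈ U i) :
    ∃ s ∈ U i, s ∈ T ∧ t ^ (p ^ i - 1) • (u - s) = 0 := by
  obtain ⟨s, ⟨hs, hsT⟩, hs'⟩ := mem_normImage.1
    (h.normImage_le_of_generators hc hspan hT hT' hi (mem_normImage.2 ⟨u, hu, rfl⟩))
  exact ⟨s, hs, hsT, by rw [smul_sub, hs', sub_self]⟩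

/-- After subtracting an element of T with the same norm class, u lies in U_{i-1} + tU_i; induction
handles the first summand and Nakayama the second. -/
theorem le_of_generators {T : Submodule A V} (hT : t • δ ∈ T)
    (hT' : ∀ i j, c i j ∈ T) {i : ℕ} (hi : i < n) : U i ≤ T := by
  induction i with
  | zero =>
    intro u hu
    obtain ⟨s, hs, hsT, hus⟩ := h.exists_mem_of_generators hc hspan hT hT' (Nat.zero_le n) hu
    have h0 : u - s = 0 := by simpa using hus
    rwa [sub_eq_zero.1 h0]
  | succ i ih =>
    refine le_of_forall_exists_add_smul h.isNilpotent fun u hu => ?_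
    obtain ⟨s, hs, hsT, hus⟩ := h.exists_mem_of_generators hc hspan hT hT' hi.le hu
    obtain ⟨y, hy, z, hz, hyz⟩ := h.ker i hi _ ((U (i + 1)).sub_mem hu hs) hus
    refine ⟨s + y, T.add_mem hsT (ih (by omega) hy), z, hz, ?_⟩
    rw [add_assoc, ← hyz]
    abel

theorem eq_top_of_generators {T : Submodule A V} (hT : δ ∈ T)
    (hT' : ∀ i j, c i j ∈ T) : T = ⊤ := by
  refine top_le_iff.1 (le_of_forall_exists_add_smul h.isNilpotent fun u _ => ?_)
  have htδ := T.smul_mem t hT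
  have hu : u ∈ U n := by rw [h.top]; trivial
  obtain ⟨s, hs, hsT, hus⟩ := h.exists_mem_of_generators hc hspan htδ hT' le_rfl hu
  -- Only at the top does the kernel of the norm involve δ itself, so here T must contain δ and not
  -- merely tδ.
  obtain ⟨y, hy, z, a, hyz⟩ := h.ker_top _ hus
  have hn := h.pos
  refine ⟨s + y + a • δ, T.add_mem (T.add_mem hsT
    (h.le_of_generators hc hspan htδ hT' (by omega) hy)) (T.smul_mem a hT), z, trivial, ?_⟩
  rw [sub_eq_iff_eq_add.1 hyz]
  abel

end Generators

theorem isUniform_span_generator :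
    IsUniform t (shiftedPow p μ + 1) (Submodule.span A {δ}) :=
  isUniform_span_singleton h.adjoin h.pow_smul_generator h.pow_smul_generator_ne_zero

/-- If m ≤ i then tX lies in U_i. If i < m, the part of tX killed by t^(p^i) is t^(p^m - p^i)(tX),
which consists of norms from K_m to K_i. -/
theorem smul_mem_of_mem_span_generator {i : ℕ} {ξ : V} (hξ : ξ ∈ Submodule.span A {δ})
    (hi : t ^ p ^ i • t • ξ = 0) : t • ξ ∈ U i := by
  have key : ∀ j, μ ≤ j + 1 → ∀ ξ ∈ Submodule.span A {δ}, t • ξ ∈ U j := by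
    intro j hj ξ hξ
    obtain ⟨a, rfl⟩ := Submodule.mem_span_singleton.1 hξ
    rw [← pow_one t, pow_smul_smul_comm h.adjoin, pow_one]
    exact (U j).smul_mem a (h.smul_mem j hj)
  rcases Nat.lt_or_ge (i + 1) μ with hμ | hμ
  · obtain ⟨j, rfl⟩ : ∃ j, μ = j + 1 := ⟨μ - 1, by omega⟩
    have h1 := h.pow_mono (show i ≤ j by omega)
    have h2 : p ^ i < p ^ j := Nat.pow_lt_pow_right h.two_le (by omega)
    obtain ⟨ζ, hζ, rfl⟩ := h.isUniform_span_generator.exists_of_pow_smul_eq_zero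
      (a := p ^ i + 1) (by rw [shiftedPow]; omega) hξ (by rw [pow_succ, mul_smul, hi])
    rw [smul_smul, ← pow_succ', pow_succ, mul_smul, shiftedPow,
      show p ^ j + 1 - (p ^ i + 1) = p ^ j - p ^ i by omega]
    exact h.norm i j (by omega) (by have := h.le; omega) _ (key j le_rfl ζ hζ)
  · exact key i hμ ξ hξ

theorem exists_decomposition : ∃ Y : Fin (n + 1) → Submodule A V,
    IsCompl (Submodule.span A {δ}) (⨆ i, Y i) ∧ iSupIndep Y ∧
    (∀ i : Fin (n + 1), ∃ S : Set (Submodule A V), sSupIndep S ∧ sSup S = Y i ∧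
      ∀ C ∈ S, (∃ x, C = Submodule.span A {x}) ∧ Module.finrank k C = p ^ (i : ℕ)) ∧
    ∀ i < n, ∀ x, x ∈ U i ↔
      (∃ ξ ∈ Submodule.span A {δ}, ∃ y ∈ ⨆ i, Y i, x = t • ξ + y) ∧ t ^ p ^ i • x = 0 := by
  obtain ⟨ι, c, hc, hspan, hne, hind⟩ := h.exists_generators
  have hlen : ∀ (i : Fin (n + 1)) j, t ^ (p ^ (i : ℕ) - 1 + 1) • c i j = 0 := fun i j => by
    rw [Nat.sub_add_cancel (h.one_le_pow i)]
    exact h.pow_smul i _ (hc i j)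
  have hindZ : iSupIndep fun y : Σ i, ι i => Submodule.span A {c y.1 y.2} :=
    iSupIndep.comp (f := some) hind (Option.some_injective _)
  have hindi : ∀ i, iSupIndep fun j => Submodule.span A {c i j} := fun i =>
    iSupIndep.comp (t := fun y : Σ i, ι i => Submodule.span A {c y.1 y.2}) (f := Sigma.mk i) hindZ
      sigma_mk_injective
  have hdisj : Disjoint (Submodule.span A {δ}) (⨆ i, ⨆ j, Submodule.span A {c i j}) := by
    have h1 := hind none
    refine Disjoint.mono_right (iSup_le fun i => iSup_le fun j => ?_) h1
    exact le_iSup₂ (f := fun (x : Option (Σ i, ι i)) (_ : x ≠ none) =>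
      Submodule.span A {Option.elim x δ fun y => c y.1 y.2}) (some ⟨i, j⟩) (Option.some_ne_none _)
  have hindY : iSupIndep fun i => ⨆ j, Submodule.span A {c i j} :=
    iSupIndep_iSup_fiber (Z := fun y : Σ i, ι i => Submodule.span A {c y.1 y.2}) hindZ
  have hcY : ∀ i j, c i j ∈ ⨆ i, ⨆ j, Submodule.span A {c i j} := fun i j =>
    Submodule.mem_iSup_of_mem i (Submodule.mem_iSup_of_mem j (Submodule.mem_span_singleton_self _))
  refine ⟨fun i => ⨆ j, Submodule.span A {c i j}, ⟨hdisj, ?_⟩, ?_, ?_, ?_⟩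
  · rw [codisjoint_iff]
    exact h.eq_top_of_generators hc hspan
      (Submodule.mem_sup_left (Submodule.mem_span_singleton_self _))
      fun i j => Submodule.mem_sup_right (hcY i j)
  · exact hindY
  · intro i
    refine ⟨Set.range fun j => Submodule.span A {c i j}, ?_, sSup_range, ?_⟩
    · exact iSupIndep.sSupIndep_range (t := fun j => Submodule.span A {c i j}) (hindi i)
    · rintro _ ⟨j, rfl⟩
      refine ⟨⟨_, rfl⟩, ?_⟩
      exact (finrank_span_singleton_of_pow_smul h.adjoin (hlen i j) (hne i j)).trans
        (Nat.sub_add_cancel (h.one_le_pow i))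
  · intro i hi x
    have hY : ∀ j : Fin (n + 1), IsUniform t (p ^ (j : ℕ)) (⨆ b, Submodule.span A {c j b}) := by
      intro j
      refine IsUniform.iSup (hindi j) fun b => ?_
      have := isUniform_span_singleton h.adjoin (hlen j b) (hne j b)
      rwa [Nat.sub_add_cancel (h.one_le_pow j)] at this
    have hYU : ∀ j : Fin (n + 1), (⨆ b, Submodule.span A {c j b}) ≤ U j := fun j =>
      iSup_le fun b => (Submodule.span_singleton_le_iff_mem _ _).2 (hc j b)
    constructor
    · intro hx
      refine ⟨?_, h.pow_smul i x hx⟩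
      obtain ⟨u, hu, y, hy, rfl⟩ := Submodule.mem_sup.1
        (h.le_of_generators hc hspan
          (T := Submodule.span A {t • δ} ⊔ ⨆ i, ⨆ j, Submodule.span A {c i j})
          (Submodule.mem_sup_left (Submodule.mem_span_singleton_self _))
          (fun i j => Submodule.mem_sup_right (hcY i j)) hi hx)
      obtain ⟨a, rfl⟩ := Submodule.mem_span_singleton.1 hu
      refine ⟨a • δ, Submodule.smul_mem _ _ (Submodule.mem_span_singleton_self _), y, hy, ?_⟩
      rw [smul_smul, smul_smul, (commute_generator h.adjoin a).eq]
    · rintro ⟨⟨ξ, hξ, y, hy, rfl⟩, h0⟩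
      have h1 : t ^ p ^ i • t • ξ = 0 := by
        rw [smul_add] at h0
        refine Submodule.disjoint_def.1 hdisj _ (Submodule.smul_mem _ _ (Submodule.smul_mem _ _ hξ))
          ?_
        rw [eq_neg_of_add_eq_zero_left h0]
        exact Submodule.neg_mem _ (Submodule.smul_mem _ _ hy)
      have h2 : t ^ p ^ i • y = 0 := by rwa [smul_add, h1, zero_add] at h0
      exact (U i).add_mem (h.smul_mem_of_mem_span_generator hξ h1)
        (h.mem_of_isUniform hindY hY hYU hy h2)

end NormFiltration

end Existence

/-! ### Norm classes in a given decomposition -/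

section Decomposition

variable {k A V : Type*} [Field k] [Ring A] [Algebra k A] [AddCommGroup V] [Module A V]
  {t : A}

namespace NormFiltration

variable {p n : ℕ} {U : ℕ → Submodule A V} {δ : V} {μ : ℕ} {Y : Fin (n + 1) → Submodule A V}

section

variable (h : NormFiltration k t p n U δ μ)
  (hind : iSupIndep Y) (hY : ∀ j : Fin (n + 1), IsUniform t (p ^ (j : ℕ)) (Y j))

include h hY

theorem pow_pred_smul_mem_iSup_ge {i : ℕ} {y : V} (hy : y ∈ ⨆ j, Y j) :
    t ^ (p ^ i - 1) • y ∈ ⨆ (j : Fin (n + 1)) (_ : i ≤ (j : ℕ)), Y j := by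
  obtain ⟨s, f, hf, rfl⟩ := exists_finset_sum_of_mem_iSup hy
  rw [Finset.smul_sum]
  refine Submodule.sum_mem _ fun j _ => ?_
  rcases Nat.lt_or_ge j i with hji | hji
  · have h1 : p ^ (j : ℕ) < p ^ i := Nat.pow_lt_pow_right h.two_le hji
    rw [pow_smul_eq_zero_of_le (l := p ^ (j : ℕ)) (by omega) ((hY j).1 _ (hf j))]
    exact Submodule.zero_mem _
  · exact Submodule.mem_iSup_of_mem j (Submodule.mem_iSup_of_mem hji
      (Submodule.smul_mem _ _ (hf j)))

include hind

/-- Componentwise, a socle element of Y_j is t^(p^j - 1) w, and p^j - 1 ≥ p^i - 1 when j ≥ i. -/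
theorem exists_pow_pred_smul_of_mem_iSup_ge {i : ℕ} {y : V}
    (hy : y ∈ ⨆ (j : Fin (n + 1)) (_ : i ≤ (j : ℕ)), Y j) (hty : t • y = 0) :
    ∃ w ∈ ⨆ j, Y j, t ^ (p ^ i - 1) • w = y := by
  obtain ⟨s, f, hf, rfl⟩ := exists_finset_sum_of_mem_iSup hy
  have hf' : ∀ j, f j ∈ Y j := fun j => (iSup_le fun _ => le_rfl : (⨆ (_ : i ≤ (j : ℕ)), Y j) ≤ Y j)
    (hf j)
  have h0 := smul_eq_zero_of_smul_sum_eq_zero hind t (fun j _ => hf' j) hty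
  have h1 : ∀ j, ∃ w ∈ Y j, j ∈ s → t ^ (p ^ i - 1) • w = f j := by
    intro j
    by_cases hj : j ∈ s
    · rcases Nat.lt_or_ge j i with hji | hji
      · have h2 : f j = 0 := by
          have := hf j
          rwa [iSup_neg (by omega), Submodule.mem_bot] at this
        exact ⟨0, Submodule.zero_mem _, fun _ => by rw [h2, smul_zero]⟩
      · obtain ⟨w, hw, hw'⟩ := (hY j).2 _ (hf' j) (h0 j hj)
        have h2 := h.pow_mono hji
        have h3 := h.one_le_pow i
        refine ⟨t ^ (p ^ (j : ℕ) - p ^ i) • w, Submodule.smul_mem _ _ hw, fun _ => ?_⟩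
        rw [← hw', smul_smul, ← pow_add]
        congr 2
        omega
    · exact ⟨0, Submodule.zero_mem _, fun h => absurd h hj⟩
  choose w hw hw' using h1
  refine ⟨∑ j ∈ s, w j, Submodule.sum_mem _ fun j _ => Submodule.mem_iSup_of_mem j (hw j), ?_⟩
  rw [Finset.smul_sum]
  exact Finset.sum_congr rfl hw'

end

variable [Module k V] [IsScalarTower k A V]
  (h : NormFiltration k t p n U δ μ) (hcompl : IsCompl (Submodule.span A {δ}) (⨆ i, Y i))
  (hind : iSupIndep Y) (hY : ∀ j : Fin (n + 1), IsUniform t (p ^ (j : ℕ)) (Y j))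
  (hU : ∀ i < n, ∀ x, x ∈ U i ↔
    (∃ ξ ∈ Submodule.span A {δ}, ∃ y ∈ ⨆ i, Y i, x = t • ξ + y) ∧ t ^ p ^ i • x = 0)

include h hcompl hind hY hU

theorem mem_normImage_iff {i : ℕ} (hi : i ≤ n) (x : V) :
    x ∈ normImage k t p i (U i) ↔ ∃ ξ ∈ Submodule.span A {δ},
      ∃ y ∈ ⨆ (j : Fin (n + 1)) (_ : i ≤ (j : ℕ)), Y j, x = ξ + y ∧ t • ξ = 0 ∧ t • y = 0 ∧
        (μ ≤ i → ξ = 0) := by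
  have hp := h.one_le_pow i
  constructor
  · intro hx
    obtain ⟨w, hw, rfl⟩ := mem_normImage.1 hx
    rcases hi.lt_or_eq with hi | rfl
    · obtain ⟨⟨ξ, hξ, y, hy, rfl⟩, h0⟩ := (hU i hi w).1 hw
      have h1 : t ^ p ^ i • t • ξ = 0 := by
        rw [smul_add] at h0
        refine Submodule.disjoint_def.1 hcompl.disjoint _
          (Submodule.smul_mem _ _ (Submodule.smul_mem _ _ hξ)) ?_
        rw [eq_neg_of_add_eq_zero_left h0]
        exact Submodule.neg_mem _ (Submodule.smul_mem _ _ hy)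
      have h2 : t ^ p ^ i • y = 0 := by rwa [smul_add, h1, zero_add] at h0
      -- The norm element multiplies tξ into t^(p^i) ξ, which vanishes for m < i because X has
      -- length p^m + 1 ≤ p^i.
      refine ⟨t ^ p ^ i • ξ, Submodule.smul_mem _ _ hξ, _,
        h.pow_pred_smul_mem_iSup_ge hY hy, ?_, ?_, ?_, ?_⟩
      · rw [smul_add, smul_smul _ t, ← pow_succ, Nat.sub_add_cancel hp]
      · rw [smul_smul, ← pow_succ', pow_succ, mul_smul, h1]
      · rw [smul_smul, ← pow_succ', Nat.sub_add_cancel hp, h2]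
      · intro hμ
        exact pow_smul_eq_zero_of_le (h.shiftedPow_lt_pow hμ) (h.isUniform_span_generator.1 ξ hξ)
    · obtain ⟨ξ, hξ, y, hy, rfl⟩ : ∃ ξ ∈ Submodule.span A {δ}, ∃ y ∈ ⨆ j, Y j, ξ + y = w := by
        rw [← Submodule.mem_sup, hcompl.sup_eq_top]
        trivial
      -- For i = n all of X contributes, not just tX, and the norm kills it since p^m + 1 ≤ p^n - 1.
      refine ⟨0, Submodule.zero_mem _, _, h.pow_pred_smul_mem_iSup_ge hY hy, ?_, smul_zero _,
        ?_, fun _ => rfl⟩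
      · have h2 := h.add_two_le
        rw [smul_add, pow_smul_eq_zero_of_le (l := shiftedPow p μ + 1) (by omega)
          (h.isUniform_span_generator.1 ξ hξ)]
      · rw [smul_smul, ← pow_succ', Nat.sub_add_cancel hp, h.pow_eq_zero, zero_smul]
  · rintro ⟨ξ, hξ, y, hy, rfl, htξ, hty, hμ⟩
    refine Submodule.add_mem _ ?_ ?_
    · rcases Nat.lt_or_ge i μ with hiμ | hiμ
      · obtain ⟨ζ, hζ, hζ'⟩ := h.isUniform_span_generator.2 ξ hξ htξ
        have h1 := h.pow_le_shiftedPow hiμ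
        refine mem_normImage.2 ⟨_, h.smul_mem_of_mem_span_generator
          (ξ := t ^ (shiftedPow p μ - p ^ i) • ζ) (Submodule.smul_mem _ _ hζ) ?_, ?_⟩
        · rw [smul_smul t, ← pow_succ', smul_smul, ← pow_add,
            show p ^ i + (shiftedPow p μ - p ^ i + 1) = shiftedPow p μ + 1 by omega]
          exact h.isUniform_span_generator.1 ζ hζ
        · rw [smul_smul t, ← pow_succ', smul_smul, ← pow_add, ← hζ']
          congr 2
          omega
      · rw [hμ hiμ]
        exact Submodule.zero_mem _
    · obtain ⟨w, hw, rfl⟩ := h.exists_pow_pred_smul_of_mem_iSup_ge hind hY hy hty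
      refine mem_normImage.2 ⟨w, ?_, rfl⟩
      have hYU : ∀ j : Fin (n + 1), Y j ≤ U j := by
        intro j x hx
        rcases Nat.lt_or_ge j n with hj | hj
        · exact (hU j hj x).2 ⟨⟨0, Submodule.zero_mem _, x, Submodule.mem_iSup_of_mem j hx, by simp⟩,
            (hY j).1 x hx⟩
        · rw [show (j : ℕ) = n by omega, h.top]
          trivial
      refine h.mem_of_isUniform hind hY hYU hw ?_
      rw [← Nat.sub_add_cancel hp, pow_succ', mul_smul, hty]

end NormFiltration

end Decomposition

/-! ### Socle dimension and free rank -/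

section Rank

variable {k A V : Type*} [Field k] [Ring A] [Algebra k A] [AddCommGroup V] [Module A V]
  {t : A} [Module k V] [IsScalarTower k A V]

theorem rank_quotient_of_disjoint {N N' P : Submodule k V} (hd : Disjoint P N')
    (hsup : P ⊔ N' = N) : Module.rank k (N ⧸ N'.submoduleOf N) = Module.rank k P := by
  subst hsup
  have h : (P ⊓ N').submoduleOf P = ⊥ := by
    rw [hd.eq_bot, Submodule.submoduleOf, Submodule.comap_bot, Submodule.ker_subtype]
  exact (LinearMap.quotientInfEquivSupQuotient P N').rank_eq.symm.trans
    (Submodule.quotEquivOfEqBot _ h).rank_eq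

/-- The elements of `W` killed by `t`, as a `k`-subspace. -/
def socle (k : Type*) [Field k] [Algebra k A] [Module k V] [IsScalarTower k A V] (t : A)
    (W : Submodule A V) : Submodule k V :=
  W.restrictScalars k ⊓ LinearMap.ker (Algebra.lsmul k k V t)

theorem mem_socle {W : Submodule A V} {x : V} : x ∈ socle k t W ↔ x ∈ W ∧ t • x = 0 := Iff.rfl

/-- Being killed by t is a componentwise condition in a direct sum, and each cyclic summand
contributes one line. -/
theorem rank_socle_of_cyclics (ht : Algebra.adjoin k {t} = ⊤) (hn : IsNilpotent t) {d : ℕ}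
    {S : Set (Submodule A V)} (hS : sSupIndep S)
    (hC : ∀ C ∈ S, (∃ x, C = Submodule.span A {x}) ∧ Module.finrank k C = d + 1) :
    Module.rank k (socle k t (sSup S)) = Cardinal.mk S := by
  choose x hx using fun C : S => (hC C C.2).1
  have hx0 : ∀ C : S, t ^ (d + 1) • x C = 0 ∧ t ^ d • x C ≠ 0 := fun C =>
    pow_smul_of_finrank_span_singleton ht hn (by rw [← hx C]; exact (hC C C.2).2)
  have hind : iSupIndep fun C : S => (C : Submodule A V) := (sSupIndep_iff S).1 hS
  have hxC : ∀ C : S, x C ∈ (C : Submodule A V) := fun C =>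
    (hx C).ge (Submodule.mem_span_singleton_self _)
  have hli : LinearIndependent k fun C : S => t ^ d • x C := by
    rw [linearIndependent_iff']
    intro s g hg C hCs
    rw [iSupIndep_iff_finsetSum_eq_zero_imp_eq_zero] at hind
    have := hind s (fun C => g C • t ^ d • x C)
      (fun C _ => Submodule.smul_of_tower_mem _ _ (Submodule.smul_mem _ _ (hxC C))) hg C hCs
    exact (smul_eq_zero.1 this).resolve_right (hx0 C).2
  have hspan : Submodule.span k (Set.range fun C : S => t ^ d • x C) = socle k t (sSup S) := by
    apply le_antisymm
    · rw [Submodule.span_le]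
      rintro _ ⟨C, rfl⟩
      refine mem_socle.2 ⟨le_sSup C.2 (Submodule.smul_mem _ _ (hxC C)), ?_⟩
      rw [smul_smul, ← pow_succ', (hx0 C).1]
    · intro w hw
      obtain ⟨hw, htw⟩ := mem_socle.1 hw
      rw [sSup_eq_iSup'] at hw
      obtain ⟨s, f, hf, rfl⟩ := exists_finset_sum_of_mem_iSup hw
      have h0 := smul_eq_zero_of_smul_sum_eq_zero hind t (fun C _ => hf C) htw
      refine Submodule.sum_mem _ fun C hCs => ?_
      obtain ⟨r, hr⟩ := exists_smul_of_mem_span_singleton_of_smul_eq_zero ht (Nat.succ_pos d)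
        (hx0 C).1 (by simpa using (hx0 C).2) (by rw [← hx C]; exact hf C) (h0 C hCs)
      rw [← hr]
      exact Submodule.smul_mem _ _ (Submodule.subset_span ⟨C, by simp⟩)
  rw [← hspan, rank_span hli, Cardinal.mk_range_eq _ hli.injective]

theorem free_of_cyclics {B : Type*} [Ring B] [Algebra k B] {W : Submodule A V}
    [Module B W] (π : A →ₐ[k] B) (hπ : Function.Surjective π)
    (hact : ∀ (a : A) (w : W), ((π a • w : W) : V) = a • (w : V)) (hB : 0 < Module.finrank k B)
    {S : Set (Submodule A V)} (hS : sSupIndep S) (hSW : sSup S = W)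
    (hC : ∀ C ∈ S, (∃ x, C = Submodule.span A {x}) ∧ Module.finrank k C = Module.finrank k B) :
    Module.Free B W ∧ Module.rank B W = Cardinal.mk S := by
  choose x hx using fun C : S => (hC C C.2).1
  have hind : iSupIndep fun C : S => (C : Submodule A V) := (sSupIndep_iff S).1 hS
  have hxC : ∀ C : S, x C ∈ (C : Submodule A V) := fun C =>
    (hx C).ge (Submodule.mem_span_singleton_self _)
  have hfin : Module.Finite k B := Module.finite_of_finrank_pos hB
  have hnt : Nontrivial B := Module.nontrivial_of_finrank_pos hB
  -- A nontrivial Noetherian ring has the strong rank condition, so the rank below is the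
  -- cardinality of the basis.
  have hnoeth : IsNoetherianRing B :=
    isNoetherian_of_tower k (inferInstanceAs (IsNoetherian k B))
  let v : S → W := fun C => ⟨x C, hSW ▸ le_sSup C.2 (hxC C)⟩
  -- The orbit map B → C is onto and both sides have the same finite dimension, so the generator has
  -- no annihilator.
  have hinj : ∀ (C : S) (b : B), b • v C = 0 → b = 0 := by
    intro C
    have hfinC : Module.Finite k (C : Submodule A V) :=
      Module.finite_of_finrank_pos (by rw [(hC C C.2).2]; exact hB)
    let g : B →ₗ[k] (C : Submodule A V) :=
      { toFun := fun b => ⟨(b • v C : W), by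
          obtain ⟨a, rfl⟩ := hπ b
          rw [hact]
          exact Submodule.smul_mem _ _ (hxC C)⟩
        map_add' := fun b b' => by ext; simp [add_smul]
        map_smul' := fun r b => by
          obtain ⟨a, rfl⟩ := hπ b
          ext
          simp only [RingHom.id_apply, Submodule.coe_smul_of_tower]
          rw [← map_smul, hact, hact, smul_assoc] }
    have hg : Function.Surjective g := by
      rintro ⟨y, hy⟩
      rw [hx C] at hy
      obtain ⟨a, rfl⟩ := Submodule.mem_span_singleton.1 hy
      exact ⟨π a, Subtype.ext (hact a (v C))⟩
    have hg' := (LinearMap.injective_iff_surjective_of_finrank_eq_finrank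
      (hC C C.2).2.symm (f := g)).2 hg
    intro b hb
    exact hg' (by ext; simp [g, hb])
  have hli : LinearIndependent B v := by
    rw [linearIndependent_iff']
    intro s g hg C hCs
    rw [iSupIndep_iff_finsetSum_eq_zero_imp_eq_zero] at hind
    refine hinj C _ (Subtype.ext (hind s (fun C => (g C • v C : W)) ?_ ?_ C hCs))
    · intro C _
      obtain ⟨a, ha⟩ := hπ (g C)
      rw [← ha, hact]
      exact Submodule.smul_mem _ _ (hxC C)
    · have := congrArg (Subtype.val) hg
      simpa using this
  have hsp : ⊤ ≤ Submodule.span B (Set.range v) := by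
    rintro ⟨w, hw⟩ -
    have hw' := hw
    rw [← hSW, sSup_eq_iSup'] at hw'
    obtain ⟨s, f, hf, rfl⟩ := exists_finset_sum_of_mem_iSup hw'
    have hf' : ∀ C : S, ∃ b : B, ((b • v C : W) : V) = f C := by
      intro C
      obtain ⟨a, ha⟩ := Submodule.mem_span_singleton.1 ((hx C).le (hf C))
      exact ⟨π a, by rw [hact, ← ha]⟩
    choose b hb using hf'
    have : (⟨∑ C ∈ s, f C, hw⟩ : W) = ∑ C ∈ s, b C • v C := by
      ext
      simp [hb]
    rw [this]
    exact Submodule.sum_mem _ fun C _ => Submodule.smul_mem _ _ (Submodule.subset_span ⟨C, rfl⟩)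
  let bas := Module.Basis.mk hli hsp
  exact ⟨Module.Free.of_basis bas, bas.mk_eq_rank''.symm⟩

end Rank

/-! ### Dimensions of the successive norm quotients -/

namespace NormFiltration

variable {k A V : Type*} [Field k] [Ring A] [Algebra k A] [AddCommGroup V] [Module A V]
  {t : A} [Module k V] [IsScalarTower k A V]
  {p n : ℕ} {U : ℕ → Submodule A V} {δ : V} {μ : ℕ} {Y : Fin (n + 1) → Submodule A V}
  (h : NormFiltration k t p n U δ μ) (hcompl : IsCompl (Submodule.span A {δ}) (⨆ i, Y i))
  (hind : iSupIndep Y) (hY : ∀ j : Fin (n + 1), IsUniform t (p ^ (j : ℕ)) (Y j))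
  (hU : ∀ i < n, ∀ x, x ∈ U i ↔
    (∃ ξ ∈ Submodule.span A {δ}, ∃ y ∈ ⨆ i, Y i, x = t • ξ + y) ∧ t ^ p ^ i • x = 0)

include h hcompl hind hY hU

/-- The socle of the part of `X ⊕ Y_i` that is not a norm from the next layer. -/
theorem normImage_eq_sup {i : ℕ} (hi : i < n) :
    Disjoint ((if μ = i + 1 then socle k t (Submodule.span A {δ}) else ⊥) ⊔
        socle k t (Y ⟨i, by omega⟩)) (normImage k t p (i + 1) (U (i + 1))) ∧
      ((if μ = i + 1 then socle k t (Submodule.span A {δ}) else ⊥) ⊔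
        socle k t (Y ⟨i, by omega⟩)) ⊔ normImage k t p (i + 1) (U (i + 1)) =
      normImage k t p i (U i) := by
  have hge : ∀ i, (⨆ (j : Fin (n + 1)) (_ : i ≤ (j : ℕ)), Y j) ≤ ⨆ j, Y j := fun i =>
    iSup_mono fun j => iSup_le fun _ => le_rfl
  have hdi : Disjoint (Y ⟨i, by omega⟩) (⨆ (j : Fin (n + 1)) (_ : i + 1 ≤ (j : ℕ)), Y j) := by
    refine (hind ⟨i, by omega⟩).mono_right (iSup_mono fun j => iSup_le fun hj => ?_)
    refine le_iSup_of_le ?_ le_rfl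
    rintro rfl
    simp at hj
  have hsplit : (⨆ (j : Fin (n + 1)) (_ : i ≤ (j : ℕ)), Y j) ≤
      Y ⟨i, by omega⟩ ⊔ ⨆ (j : Fin (n + 1)) (_ : i + 1 ≤ (j : ℕ)), Y j := by
    refine iSup₂_le fun j hj => ?_
    rcases hj.eq_or_lt with hj | hj
    · rw [show j = ⟨i, by omega⟩ from Fin.ext hj.symm]
      exact le_sup_left
    · exact le_sup_of_le_right (le_iSup₂_of_le j hj le_rfl)
  have hX : ∀ x, x ∈ (if μ = i + 1 then socle k t (Submodule.span A {δ}) else ⊥) →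
      x ∈ Submodule.span A {δ} ∧ t • x = 0 ∧ (μ ≠ i + 1 → x = 0) := by
    intro x hx
    split_ifs at hx with hμ
    · exact ⟨(mem_socle.1 hx).1, (mem_socle.1 hx).2, fun h => absurd hμ h⟩
    · rw [Submodule.mem_bot] at hx
      subst hx
      exact ⟨Submodule.zero_mem _, smul_zero _, fun _ => rfl⟩
  constructor
  · rw [Submodule.disjoint_def]
    intro x hx hx'
    obtain ⟨ζ, hζ, y, hy, rfl⟩ := Submodule.mem_sup.1 hx
    obtain ⟨hζX, htζ, hζμ⟩ := hX ζ hζ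
    obtain ⟨hyY, hty⟩ := mem_socle.1 hy
    obtain ⟨ξ, hξ, y', hy', heq, -, -, hμ⟩ :=
      (h.mem_normImage_iff hcompl hind hY hU hi _).1 hx'
    have h1 : ζ - ξ = y' - y := by rw [sub_eq_sub_iff_add_eq_add, heq, add_comm]
    have h2 : ζ - ξ = 0 := by
      refine Submodule.disjoint_def.1 hcompl.disjoint _ (Submodule.sub_mem _ hζX hξ) ?_
      rw [h1]
      exact Submodule.sub_mem _ (hge _ hy') (Submodule.mem_iSup_of_mem _ hyY)
    have h3 : y' = y := sub_eq_zero.1 (h1.symm.trans h2)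
    have h4 : y = 0 := Submodule.disjoint_def.1 hdi _ hyY (h3 ▸ hy')
    have h5 : ζ = 0 := by
      by_cases hμi : μ = i + 1
      · rw [sub_eq_zero.1 h2, hμ hμi.le]
      · exact hζμ hμi
    rw [h4, h5, add_zero]
  · apply le_antisymm
    · refine sup_le (sup_le ?_ ?_) (h.normImage_succ_le i)
      · intro x hx
        obtain ⟨hxX, htx, hxμ⟩ := hX x hx
        refine (h.mem_normImage_iff hcompl hind hY hU hi.le _).2
          ⟨x, hxX, 0, Submodule.zero_mem _, by simp, htx, by simp, fun hμ => hxμ (by omega)⟩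
      · intro y hy
        obtain ⟨hyY, hty⟩ := mem_socle.1 hy
        exact (h.mem_normImage_iff hcompl hind hY hU hi.le _).2
          ⟨0, Submodule.zero_mem _, y, (le_iSup₂_of_le (f := fun (j : Fin (n + 1))
            (_ : i ≤ (j : ℕ)) => Y j) ⟨i, by omega⟩ le_rfl le_rfl) hyY, by simp, by simp, hty,
            fun _ => rfl⟩
    · intro x hx
      obtain ⟨ξ, hξ, y, hy, rfl, htξ, hty, hμ⟩ :=
        (h.mem_normImage_iff hcompl hind hY hU hi.le _).1 hx
      obtain ⟨z, hz, w, hw, rfl⟩ := Submodule.mem_sup.1 (hsplit hy)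
      have htz : t • z = 0 := by
        rw [smul_add] at hty
        refine Submodule.disjoint_def.1 hdi _ (Submodule.smul_mem _ _ hz) ?_
        rw [eq_neg_of_add_eq_zero_left hty]
        exact Submodule.neg_mem _ (Submodule.smul_mem _ _ hw)
      have htw : t • w = 0 := by rwa [smul_add, htz, zero_add] at hty
      have hz' := (mem_socle (k := k)).2 ⟨hz, htz⟩
      by_cases hμi : μ = i + 1
      · rw [← add_assoc]
        refine Submodule.add_mem_sup (Submodule.add_mem_sup ?_ hz') ?_
        · rw [if_pos hμi]
          exact mem_socle.2 ⟨hξ, htξ⟩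
        · exact (h.mem_normImage_iff hcompl hind hY hU hi _).2
            ⟨0, Submodule.zero_mem _, w, hw, by simp, by simp, htw, fun _ => rfl⟩
      · rw [add_left_comm]
        refine Submodule.add_mem_sup (Submodule.mem_sup_right hz') ?_
        exact (h.mem_normImage_iff hcompl hind hY hU hi _).2
          ⟨ξ, hξ, w, hw, rfl, htξ, htw, fun hμ' => hμ (by omega)⟩

theorem rank_normImage_quotient_of_ne {i : ℕ} (hi : i < n) (hμ : μ ≠ i + 1) :
    Module.rank k (normImage k t p i (U i) ⧸
      (normImage k t p (i + 1) (U (i + 1))).submoduleOf (normImage k t p i (U i))) =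
      Module.rank k (socle k t (Y ⟨i, by omega⟩)) := by
  obtain ⟨hd, hsup⟩ := h.normImage_eq_sup hcompl hind hY hU hi
  rw [if_neg hμ, bot_sup_eq] at hd hsup
  exact rank_quotient_of_disjoint hd hsup

/-- The extra 1 is the socle line of X, which belongs to N_m but not to N_{m+1}. -/
theorem rank_normImage_quotient_of_eq {i : ℕ} (hi : i < n) (hμ : μ = i + 1) :
    Module.rank k (normImage k t p i (U i) ⧸
      (normImage k t p (i + 1) (U (i + 1))).submoduleOf (normImage k t p i (U i))) =
      1 + Module.rank k (socle k t (Y ⟨i, by omega⟩)) := by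
  obtain ⟨hd, hsup⟩ := h.normImage_eq_sup hcompl hind hY hU hi
  rw [if_pos hμ] at hd hsup
  rw [rank_quotient_of_disjoint hd hsup]
  have hsoc : socle k t (Submodule.span A {δ}) =
      Submodule.span k {t ^ shiftedPow p μ • δ} := by
    apply le_antisymm
    · intro x hx
      obtain ⟨hx, htx⟩ := mem_socle.1 hx
      obtain ⟨r, hr⟩ := exists_smul_of_mem_span_singleton_of_smul_eq_zero h.adjoin
        (Nat.succ_pos _) h.pow_smul_generator (by simpa using h.pow_smul_generator_ne_zero) hx htx
      rw [← hr]
      exact Submodule.smul_mem _ _ (Submodule.mem_span_singleton_self _)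
    · rw [Submodule.span_le, Set.singleton_subset_iff]
      refine mem_socle.2 ⟨Submodule.smul_mem _ _ (Submodule.mem_span_singleton_self _), ?_⟩
      rw [smul_smul, ← pow_succ', h.pow_smul_generator]
  have hdisj : Disjoint (socle k t (Submodule.span A {δ})) (socle k t (Y ⟨i, by omega⟩)) := by
    rw [Submodule.disjoint_def]
    intro x hx hx'
    exact Submodule.disjoint_def.1 hcompl.disjoint x (mem_socle.1 hx).1
      (Submodule.mem_iSup_of_mem _ (mem_socle.1 hx').1)
  have := Submodule.rank_sup_add_rank_inf_eq (socle k t (Submodule.span A {δ}))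
    (socle k t (Y ⟨i, by omega⟩))
  rw [hdisj.eq_bot, rank_bot, add_zero] at this
  rw [this, hsoc, Module.rank_eq_one_iff_finrank_eq_one.2
    (finrank_span_singleton h.pow_smul_generator_ne_zero)]

theorem normImage_top_eq : normImage k t p n (U n) = socle k t (Y (Fin.last n)) := by
  have hge : (⨆ (j : Fin (n + 1)) (_ : n ≤ (j : ℕ)), Y j) = Y (Fin.last n) := by
    apply le_antisymm
    · refine iSup₂_le fun j hj => ?_
      rw [show j = Fin.last n from Fin.ext (le_antisymm (Nat.lt_succ_iff.1 j.2) hj)]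
    · exact le_iSup₂_of_le (f := fun (j : Fin (n + 1)) (_ : n ≤ (j : ℕ)) => Y j) (Fin.last n)
        le_rfl le_rfl
  ext x
  rw [h.mem_normImage_iff hcompl hind hY hU le_rfl, hge, mem_socle]
  constructor
  · rintro ⟨ξ, -, y, hy, rfl, -, hty, hμ⟩
    rw [hμ h.le, zero_add]
    exact ⟨hy, hty⟩
  · rintro ⟨hx, htx⟩
    exact ⟨0, Submodule.zero_mem _, x, hx, by simp, by simp, htx, fun _ => rfl⟩

end NormFiltration

/-! ### Powers of g - 1 in characteristic p -/

section GroupRing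

/-- Frobenius in 𝔽_p[X], evaluated at g; passing through polynomials avoids assuming A commutative.
-/
theorem sub_one_pow_prime_pow {p : ℕ} [Fact p.Prime] {A : Type*} [Ring A] [Algebra (ZMod p) A]
    (g : A) (i : ℕ) : (g - 1) ^ p ^ i = g ^ p ^ i - 1 := by
  have h : ((Polynomial.X : Polynomial (ZMod p)) - 1) ^ p ^ i = Polynomial.X ^ p ^ i - 1 := by
    rw [sub_pow_char_pow, one_pow]
  simpa using congrArg (Polynomial.aeval g) h

/-- Both sides times X - 1 equal X^(p^i) - 1 in the domain 𝔽_p[X]. This identifies t^(p^i - 1) with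
a norm element. -/
theorem sub_one_pow_pred_prime_pow {p : ℕ} [Fact p.Prime] {A : Type*} [Ring A]
    [Algebra (ZMod p) A] (g : A) (i : ℕ) :
    (g - 1) ^ (p ^ i - 1) = ∑ l ∈ Finset.range (p ^ i), g ^ l := by
  have hX : (Polynomial.X : Polynomial (ZMod p)) - 1 ≠ 0 := by
    simpa using Polynomial.X_sub_C_ne_zero (1 : ZMod p)
  have hp : 0 < p ^ i := pow_pos (Fact.out : p.Prime).pos i
  have h : ((Polynomial.X : Polynomial (ZMod p)) - 1) ^ (p ^ i - 1) =
      ∑ l ∈ Finset.range (p ^ i), Polynomial.X ^ l := by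
    apply mul_right_cancel₀ hX
    rw [geom_sum_mul, ← pow_succ, Nat.sub_add_cancel hp, sub_one_pow_prime_pow]
  simpa using congrArg (Polynomial.aeval g) h

end GroupRing

/-! ### Partial norms along a cyclic group -/

section PartialNorm

variable {F : Type u} {K : Type v} [Field F] [Field K] [Algebra F K]

/-- The partial norm `∏_{l < N} τ^l x`. -/
def partialNorm (τ : K ≃ₐ[F] K) (N : ℕ) (x : K) : K := ∏ l ∈ Finset.range N, (τ ^ l) x

theorem partialNorm_pow (τ : K ≃ₐ[F] K) (N : ℕ) (x : K) (s : ℕ) :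
    partialNorm τ N (x ^ s) = partialNorm τ N x ^ s := by
  simp [partialNorm, Finset.prod_pow]

theorem partialNorm_div (τ : K ≃ₐ[F] K) (N : ℕ) (x y : K) :
    partialNorm τ N (x / y) = partialNorm τ N x / partialNorm τ N y := by
  simp [partialNorm, Finset.prod_div_distrib]

theorem partialNorm_ne_zero (τ : K ≃ₐ[F] K) (N : ℕ) {x : K} (hx : x ≠ 0) :
    partialNorm τ N x ≠ 0 :=
  Finset.prod_ne_zero_iff.2 fun _ _ => EmbeddingLike.map_ne_zero_iff.2 hx

theorem partialNorm_of_fixed (τ : K ≃ₐ[F] K) (N : ℕ) {x : K} (hx : τ x = x) :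
    partialNorm τ N x = x ^ N := by
  have h : ∀ l : ℕ, (τ ^ l) x = x := by
    intro l
    induction l with
    | zero => simp
    | succ l ih => rw [pow_succ, AlgEquiv.mul_apply, hx, ih]
  simp [partialNorm, h]

theorem apply_partialNorm_mul (τ : K ≃ₐ[F] K) (N : ℕ) (x : K) :
    τ (partialNorm τ N x) * x = partialNorm τ N x * (τ ^ N) x := by
  rw [partialNorm, ← Finset.prod_range_succ, Finset.prod_range_succ', map_prod]
  simp [pow_succ', AlgEquiv.mul_apply]

theorem partialNorm_apply_div (τ : K ≃ₐ[F] K) (N : ℕ) {x : K} (hx : x ≠ 0) :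
    partialNorm τ N (τ x / x) = (τ ^ N) x / x := by
  induction N with
  | zero => simp [partialNorm, hx]
  | succ N ih =>
    rw [partialNorm, Finset.prod_range_succ, ← partialNorm, ih, map_div₀, ← AlgEquiv.mul_apply,
      ← pow_succ]
    have : (τ ^ N) x ≠ 0 := EmbeddingLike.map_ne_zero_iff.2 hx
    field_simp

theorem partialNorm_partialNorm (τ : K ≃ₐ[F] K) (N M : ℕ) (x : K) :
    partialNorm (τ ^ N) M (partialNorm τ N x) = partialNorm τ (N * M) x := by
  induction M with
  | zero => simp [partialNorm]
  | succ M ih =>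
    rw [partialNorm, Finset.prod_range_succ, ← partialNorm, ih, Nat.mul_succ, partialNorm,
      partialNorm, partialNorm, Finset.prod_range_add, map_prod]
    simp [pow_add, pow_mul, AlgEquiv.mul_apply]

theorem partialNorm_pow_partialNorm (τ : K ≃ₐ[F] K) (N M : ℕ) (x : K) :
    partialNorm τ N (partialNorm (τ ^ N) M x) = partialNorm τ (N * M) x := by
  rw [← partialNorm_partialNorm]
  simp only [partialNorm, map_prod]
  rw [Finset.prod_comm]
  refine Finset.prod_congr rfl fun i _ => Finset.prod_congr rfl fun j _ => ?_
  rw [← AlgEquiv.mul_apply, ← AlgEquiv.mul_apply, ← pow_mul, ← pow_add, ← pow_add, add_comm]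

theorem algebraMap_norm_eq_partialNorm [FiniteDimensional F K] [IsGalois F K] {σ : K ≃ₐ[F] K}
    (hσ : ∀ τ : K ≃ₐ[F] K, τ ∈ Subgroup.zpowers σ) (x : K) :
    algebraMap F K (Algebra.norm F x) = partialNorm σ (Nat.card (K ≃ₐ[F] K)) x := by
  classical
  rw [Algebra.norm_eq_prod_automorphisms, ← IsCyclic.image_range_card hσ, Finset.prod_image]
  · simp [partialNorm]
  · rw [← orderOf_eq_card_of_forall_mem_zpowers hσ, Finset.coe_range]
    exact pow_injOn_Iio_orderOf

end PartialNorm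

/-! ### The tower of layers and Hilbert 90 -/

section Layers

variable {p n : ℕ} {F : Type u} {K : Type v} [Field F] [Field K] [Algebra F K]
  {σ : K ≃ₐ[F] K}

theorem mem_layer_iff {i : ℕ} {x : K} : x ∈ layer p σ i ↔ (σ ^ p ^ i) x = x := by
  rw [layer, IntermediateField.mem_fixedField_iff]
  constructor
  · exact fun h => h _ (Subgroup.mem_zpowers _)
  · intro h τ hτ
    have hle : layerGroup p σ i ≤ MulAction.stabilizer (K ≃ₐ[F] K) x := by
      rw [layerGroup, Subgroup.zpowers_le]
      exact h
    exact hle hτ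

theorem apply_mem_layer {i : ℕ} {x : K} (hx : x ∈ layer p σ i) (j : ℕ) :
    (σ ^ j) x ∈ layer p σ i := by
  rw [mem_layer_iff] at hx ⊢
  rw [← AlgEquiv.mul_apply, ← pow_add, add_comm, pow_add, AlgEquiv.mul_apply, hx]

theorem layer_mono : Monotone (layer p σ) := by
  refine monotone_nat_of_le_succ fun i x hx => ?_
  rw [mem_layer_iff] at hx ⊢
  rw [pow_succ, pow_mul]
  have h : ∀ l : ℕ, ((σ ^ p ^ i) ^ l) x = x := by
    intro l
    induction l with
    | zero => simp
    | succ l ih => rw [pow_succ, AlgEquiv.mul_apply, hx, ih]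
  exact h p

theorem pow_prime_pow_eq_one (hcard : Nat.card (K ≃ₐ[F] K) = p ^ n) : σ ^ p ^ n = 1 := by
  rw [← hcard]; exact pow_card_eq_one'

theorem mem_layer_top (hcard : Nat.card (K ≃ₐ[F] K) = p ^ n) (x : K) : x ∈ layer p σ n := by
  rw [mem_layer_iff, pow_prime_pow_eq_one hcard]; rfl

variable [FiniteDimensional F K]

theorem mem_range_algebraMap_of_fixed [IsGalois F K]
    (hσ : ∀ τ : K ≃ₐ[F] K, τ ∈ Subgroup.zpowers σ) {x : K} (hx : σ x = x) :
    ∃ f : F, algebraMap F K f = x := by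
  refine (IsGalois.mem_range_algebraMap_iff_fixed x).2 fun τ => ?_
  have hle : Subgroup.zpowers σ ≤ MulAction.stabilizer (K ≃ₐ[F] K) x := by
    rw [Subgroup.zpowers_le]
    exact hx
  exact hle (hσ τ)

variable [Fact p.Prime]
  (hσ : ∀ τ : K ≃ₐ[F] K, τ ∈ Subgroup.zpowers σ) (hcard : Nat.card (K ≃ₐ[F] K) = p ^ n)

include hcard

include hσ

/-- Hilbert's Theorem 90 for the extension `K_i / K_l`. -/
theorem exists_apply_eq_mul {l i : ℕ} (hli : l ≤ i) (hi : i ≤ n) {x : K} (hx : x ∈ layer p σ i)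
    (h1 : partialNorm (σ ^ p ^ l) (p ^ (i - l)) x = 1) :
    ∃ ω ∈ layer p σ i, ω ≠ 0 ∧ (σ ^ p ^ l) ω = x * ω := by
  have hp := (Fact.out : p.Prime).pos
  set τ := σ ^ p ^ l with hτ
  set r := p ^ (i - l) with hr
  have hord : orderOf σ = p ^ n := by
    rw [← hcard]; exact orderOf_eq_card_of_forall_mem_zpowers hσ
  let f : Fin r → (layer p σ i →* K) := fun j =>
    ((τ ^ (j : ℕ) : K ≃ₐ[F] K) : K →* K).comp ((layer p σ i).val : layer p σ i →* K)
  have hf : Function.Injective f := by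
    -- Two equal embeddings would put σ^(p^l (b - a)) in H_i, forcing p^(i-l) to divide b - a, which
    -- is too small. The embeddings are therefore independent by Dedekind.
    have key : ∀ a b : Fin r, a < b → f a ≠ f b := by
      intro a b hab h
      have hfix : τ ^ ((b : ℕ) - a) ∈ (layer p σ i).fixingSubgroup := by
        rw [IntermediateField.mem_fixingSubgroup_iff]
        intro y hy
        have h2 : (τ ^ (a : ℕ)) y = (τ ^ (b : ℕ)) y := DFunLike.congr_fun h ⟨y, hy⟩
        rw [← Nat.add_sub_cancel' (show (a : ℕ) ≤ b from hab.le), pow_add, AlgEquiv.mul_apply] at h2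
        exact ((τ ^ (a : ℕ)).injective h2).symm
      rw [fixingSubgroup_layer, layerGroup, hτ, ← pow_mul] at hfix
      obtain ⟨z, hz⟩ := Subgroup.mem_zpowers_iff.1 hfix
      have h3 : σ ^ ((p ^ i : ℕ) * z - (p ^ l * ((b : ℕ) - a) : ℕ) : ℤ) = 1 := by
        rw [zpow_sub, zpow_mul, zpow_natCast, zpow_natCast, hz, mul_inv_cancel]
      have h4 := orderOf_dvd_iff_zpow_eq_one.2 h3
      rw [hord] at h4
      have h5 : ((p ^ i : ℕ) : ℤ) ∣ ((p ^ l * ((b : ℕ) - a) : ℕ) : ℤ) := by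
        have h6 : ((p ^ i : ℕ) : ℤ) ∣ (p ^ i : ℕ) * z - (p ^ l * ((b : ℕ) - a) : ℕ) :=
          (Int.natCast_dvd_natCast.2 (pow_dvd_pow p hi)).trans h4
        exact (dvd_sub_right (Dvd.intro z rfl)).1 h6
      have h6 := Int.natCast_dvd_natCast.1 h5
      rw [← Nat.add_sub_cancel' hli, pow_add] at h6
      have h7 := Nat.le_of_dvd (by have : (a : ℕ) < b := hab; omega)
        (Nat.dvd_of_mul_dvd_mul_left (pow_pos hp l) h6)
      have := b.2
      omega
    intro a b hab
    rcases lt_trichotomy a b with h | h | h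
    · exact absurd hab (key a b h)
    · exact h
    · exact absurd hab.symm (key b a h)
  have hli' := (linearIndependent_monoidHom (layer p σ i) K).comp f hf
  have hrpos : 0 < r := pow_pos hp _
  -- The Lagrange resolvent w built from the partial norms of x satisfies x · τ w = w because the
  -- full norm is 1, so its inverse solves the equation.
  have hex : ∃ θ : layer p σ i,
      ∑ j ∈ Finset.range r, partialNorm τ j x * (τ ^ j) (θ : K) ≠ 0 := by
    by_contra! hall
    have h2 := Fintype.linearIndependent_iff.1 hli' (fun j => partialNorm τ j x) (by
      funext θ
      rw [Finset.sum_apply]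
      have := hall θ
      rw [Finset.sum_range] at this
      exact this) ⟨0, hrpos⟩
    simp [partialNorm] at h2
  obtain ⟨θ, hθ⟩ := hex
  set w := ∑ j ∈ Finset.range r, partialNorm τ j x * (τ ^ j) (θ : K) with hw
  have hτr : (τ ^ r) (θ : K) = θ := by
    rw [hτ, hr, ← pow_mul, ← pow_add, Nat.add_sub_cancel' hli]
    exact mem_layer_iff.1 θ.2
  have hτlayer : ∀ y ∈ layer p σ i, ∀ j, (τ ^ j) y ∈ layer p σ i := by
    intro y hy j
    rw [hτ, ← pow_mul]
    exact apply_mem_layer hy _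
  have hxw : x * τ w = w := by
    have hstep : ∀ j, x * τ (partialNorm τ j x * (τ ^ j) (θ : K)) =
        partialNorm τ (j + 1) x * (τ ^ (j + 1)) (θ : K) := by
      intro j
      have h3 : partialNorm τ (j + 1) x = partialNorm τ j x * (τ ^ j) x := by
        rw [partialNorm, Finset.prod_range_succ, ← partialNorm]
      rw [map_mul, ← mul_assoc, mul_comm x, apply_partialNorm_mul, ← h3, pow_succ' τ j,
        AlgEquiv.mul_apply]
    have h4 := Finset.sum_range_succ' (fun j => partialNorm τ j x * (τ ^ j) (θ : K)) r
    rw [Finset.sum_range_succ, ← hw, h1, hτr] at h4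
    rw [hw, map_sum, Finset.mul_sum, Finset.sum_congr rfl fun j _ => hstep j, ← hw]
    have h5 : partialNorm τ 0 x * (τ ^ 0) (θ : K) = 1 * (θ : K) := by simp [partialNorm]
    rw [h5] at h4
    exact (add_right_cancel h4).symm
  have hwmem : w ∈ layer p σ i := by
    refine sum_mem fun j _ => mul_mem (prod_mem fun l _ => hτlayer x hx l) (hτlayer θ θ.2 j)
  refine ⟨w⁻¹, inv_mem hwmem, inv_ne_zero hθ, ?_⟩
  have hτw : τ w ≠ 0 := by simpa using hθ
  rw [map_inv₀]
  nth_rewrite 2 [← hxw]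
  have hx0 : x ≠ 0 := by
    rintro rfl
    rw [zero_mul] at hxw
    exact hθ hxw.symm
  field_simp

/-- If the norm of `γ ∈ K_{i+1}` is a `p`th power in `F`, then `γ` is a product of an element of
`K_i` and an element `σ ω / ω`. -/
theorem exists_mul_apply_div_of_partialNorm_eq_pow {i : ℕ} (hi : i + 1 ≤ n) {γ : K} (hγ0 : γ ≠ 0)
    (hγ : γ ∈ layer p σ (i + 1)) {f : F}
    (hf : partialNorm σ (p ^ (i + 1)) γ = algebraMap F K f ^ p) :
    ∃ z ∈ layer p σ i, ∃ ω ∈ layer p σ (i + 1), z ≠ 0 ∧ ω ≠ 0 ∧ γ = z * (σ ω / ω) := by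
  have hp := (Fact.out : p.Prime).pos
  have hf0 : algebraMap F K f ≠ 0 := by
    intro h0
    rw [h0, zero_pow hp.ne'] at hf
    exact partialNorm_ne_zero _ _ hγ0 hf
  set y := partialNorm σ (p ^ i) γ with hy
  -- The norm of y from K_{i+1} to K_i is the norm of γ to F, namely f^p, and this is also the norm
  -- of f.
  have h1 : partialNorm (σ ^ p ^ i) (p ^ (i + 1 - i)) (y / algebraMap F K f) = 1 := by
    rw [partialNorm_div, hy, partialNorm_partialNorm,
      partialNorm_of_fixed _ _ (AlgEquiv.commutes _ f), ← pow_add,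
      show i + (i + 1 - i) = i + 1 by omega, hf, show i + 1 - i = 1 by omega, pow_one,
      div_self (pow_ne_zero _ hf0)]
  have hymem : y ∈ layer p σ (i + 1) := prod_mem fun l _ => apply_mem_layer hγ l
  obtain ⟨ω, hω, hω0, hσω⟩ := exists_apply_eq_mul hσ hcard (Nat.le_succ i) hi
    (div_mem hymem (IntermediateField.algebraMap_mem _ f)) h1
  have hσω0 : σ ω ≠ 0 := by simpa using hω0
  have hσωmem : σ ω ∈ layer p σ (i + 1) := by simpa using apply_mem_layer hω 1
  -- The partial norm of σω/ω telescopes to σ^(p^i) ω/ω = y/f. A nonzero element whose partial norm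
  -- of length p^i is fixed by σ is itself fixed by σ^(p^i).
  have hz : partialNorm σ (p ^ i) (γ / (σ ω / ω)) = algebraMap F K f := by
    have hy0 : y ≠ 0 := partialNorm_ne_zero _ _ hγ0
    rw [partialNorm_div, partialNorm_apply_div _ _ hω0, hσω, ← hy]
    field_simp
  refine ⟨γ / (σ ω / ω), ?_, ω, hω, div_ne_zero hγ0 (div_ne_zero hσω0 hω0), hω0, ?_⟩
  · rw [mem_layer_iff]
    have := apply_partialNorm_mul σ (p ^ i) (γ / (σ ω / ω))
    rw [hz, AlgEquiv.commutes] at this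
    exact (mul_left_cancel₀ hf0 this).symm
  · rw [div_mul_cancel₀ _ (div_ne_zero hσω0 hω0)]

variable [IsGalois F K]

/-- Gal(K_i/F) is cyclic of order p^i, generated by the restriction of σ. -/
theorem coe_norm_layer {i : ℕ} (hi : i ≤ n) (x : layer p σ i) :
    algebraMap F K (Algebra.norm F x) = partialNorm σ (p ^ i) (x : K) := by
  have hcomm : ∀ a b : K ≃ₐ[F] K, a * b = b * a := by
    intro a b
    obtain ⟨j, rfl⟩ := hσ a
    obtain ⟨l, rfl⟩ := hσ b
    exact (((Commute.refl σ).zpow_zpow j l).eq)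
  have hnormal : (layerGroup p σ i).Normal :=
    ⟨fun a ha b => by rwa [hcomm b a, mul_inv_cancel_right]⟩
  have hgal : IsGalois F (layer p σ i) := IsGalois.of_fixedField_normal_subgroup _
  have hs : ∀ τ : layer p σ i ≃ₐ[F] layer p σ i,
      τ ∈ Subgroup.zpowers (AlgEquiv.restrictNormalHom (layer p σ i) σ) := by
    intro τ
    obtain ⟨τ', rfl⟩ := AlgEquiv.restrictNormalHom_surjective (F := F)
      (K₁ := layer p σ i) (E := K) τ
    obtain ⟨j, rfl⟩ := hσ τ'
    exact ⟨j, (map_zpow _ _ _).symm⟩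
  rw [IsScalarTower.algebraMap_apply F (layer p σ i) K, algebraMap_norm_eq_partialNorm hs,
    IsGalois.card_aut_eq_finrank, finrank_layer p n σ hσ hcard i hi, partialNorm, partialNorm,
    map_prod]
  refine Finset.prod_congr rfl fun l _ => ?_
  rw [← map_pow]
  exact AlgEquiv.restrictNormal_commutes (σ ^ l) (layer p σ i) x

end Layers

/-! ### The Galois module of pth-power classes -/

section ClassGroup

variable {p n : ℕ} {F : Type u} {K : Type v} [Field F] [Field K] [Algebra F K]

/-- The element `σ - 1` of `𝔽_p[G]`. -/
noncomputable def augGen (p : ℕ) (σ : K ≃ₐ[F] K) : MonoidAlgebra (ZMod p) (K ≃ₐ[F] K) :=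
  MonoidAlgebra.of (ZMod p) (K ≃ₐ[F] K) σ - 1

theorem augGen_smul (σ : K ≃ₐ[F] K) (x : J p K) : augGen p σ • x = galRep p σ x - x := by
  rw [augGen, sub_smul, one_smul, of_smul]

theorem cls_one : cls p (1 : Kˣ) = 0 := (cls_eq_zero_iff p 1).2 ⟨1, one_pow p⟩

theorem cls_prod {ι : Type*} (s : Finset ι) (f : ι → Kˣ) :
    cls p (∏ i ∈ s, f i) = ∑ i ∈ s, cls p (f i) := by
  classical
  induction s using Finset.induction_on with
  | empty => simp [cls_one]
  | insert i s hi ih => rw [Finset.prod_insert hi, Finset.sum_insert hi, cls_mul, ih]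

theorem cls_div (a b : Kˣ) : cls p (a / b) = cls p a - cls p b := by
  rw [eq_sub_iff_add_eq, ← cls_mul, div_mul_cancel]

theorem cls_pow (a : Kˣ) (s : ℕ) : cls p (a ^ s) = s • cls p a := by
  induction s with
  | zero => simp [cls_one]
  | succ s ih => rw [pow_succ, cls_mul, ih, succ_nsmul]

theorem augGen_smul_cls (σ : K ≃ₐ[F] K) (γ γ' : Kˣ) (h : (γ' : K) = σ γ / γ) :
    augGen p σ • cls p γ = cls p γ' := by
  rw [augGen_smul, galRep_cls, ← cls_div]
  congr 1
  ext
  rw [h, Units.val_div_eq_div_val]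
  rfl

/-- The map `J(K) → J(F)` induced by the norm. -/
noncomputable def normMap (p : ℕ) (F : Type u) (K : Type v) [Field F] [Field K] [Algebra F K] :
    J p K →+ J p F :=
  MonoidHom.toAdditive
    (QuotientGroup.map _ (powMonoidHom p : Fˣ →* Fˣ).range (Units.map (Algebra.norm F : K →* F)) (by
      rintro _ ⟨γ, rfl⟩
      exact ⟨Units.map (Algebra.norm F : K →* F) γ, by simp⟩))

theorem normMap_cls (γ : Kˣ) :
    normMap p F K (cls p γ) = cls p (Units.map (Algebra.norm F : K →* F) γ) := rfl

theorem normMap_augGen_smul (σ : K ≃ₐ[F] K) (x : J p K) : normMap p F K (augGen p σ • x) = 0 := by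
  obtain ⟨γ, rfl⟩ := cls_surjective p x
  rw [augGen_smul, map_sub, galRep_cls, normMap_cls, normMap_cls, sub_eq_zero]
  congr 1
  ext
  exact Algebra.norm_eq_of_algEquiv σ (γ : K)

theorem mem_layerClasses_iff {σ : K ≃ₐ[F] K} {i : ℕ} {x : J p K} :
    x ∈ layerClasses p σ i ↔ ∃ γ : Kˣ, (γ : K) ∈ layer p σ i ∧ cls p γ = x := by
  rw [layerClasses, mem_classes]
  constructor
  · rintro ⟨a, rfl⟩
    exact ⟨_, a.1.2, rfl⟩
  · rintro ⟨γ, hγ, rfl⟩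
    have h0 : (⟨γ, hγ⟩ : layer p σ i) ≠ 0 := fun h => γ.ne_zero (congrArg Subtype.val h)
    refine ⟨Units.mk0 _ h0, ?_⟩
    congr 1
    ext
    rfl

variable [Fact p.Prime]

theorem partialNorm_mem_layer {σ : K ≃ₐ[F] K} {i j : ℕ} (hij : i ≤ j) {x : K}
    (hx : x ∈ layer p σ j) :
    partialNorm (σ ^ p ^ i) (p ^ (j - i)) x ∈ layer p σ i := by
  by_cases hx0 : x = 0
  · have : partialNorm (σ ^ p ^ i) (p ^ (j - i)) (0 : K) = 0 :=
      Finset.prod_eq_zero (Finset.mem_range.2 (pow_pos (Fact.out : p.Prime).pos _)) (map_zero _)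
    rw [hx0, this]
    exact zero_mem _
  · rw [mem_layer_iff]
    have h1 := apply_partialNorm_mul (σ ^ p ^ i) (p ^ (j - i)) x
    rw [← pow_mul, ← pow_add, Nat.add_sub_cancel' hij, mem_layer_iff.1 hx] at h1
    exact mul_right_cancel₀ hx0 h1

theorem augGen_pow (σ : K ≃ₐ[F] K) (i : ℕ) :
    augGen p σ ^ p ^ i = augGen p (σ ^ p ^ i) := by
  rw [augGen, augGen, sub_one_pow_prime_pow, map_pow]

theorem augGen_pow_eq_zero {σ : K ≃ₐ[F] K} (hcard : Nat.card (K ≃ₐ[F] K) = p ^ n) :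
    augGen p σ ^ p ^ n = 0 := by
  rw [augGen_pow, pow_prime_pow_eq_one hcard, augGen, map_one, sub_self]

theorem augGen_pow_pred_smul_cls (σ : K ≃ₐ[F] K) (i : ℕ) (γ γ' : Kˣ)
    (h : (γ' : K) = partialNorm σ (p ^ i) γ) :
    augGen p σ ^ (p ^ i - 1) • cls p γ = cls p γ' := by
  rw [augGen, sub_one_pow_pred_prime_pow, Finset.sum_smul,
    show γ' = ∏ l ∈ Finset.range (p ^ i), Units.map ((σ ^ l : K ≃ₐ[F] K) : K →* K) γ from by
      ext; rw [h, partialNorm, Units.coe_prod]; rfl, cls_prod]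
  refine Finset.sum_congr rfl fun l _ => ?_
  rw [← map_pow, of_smul, galRep_cls]

/-- Since p^j - p^i = p^i (p^(j-i) - 1), this power of t is (σ^(p^i) - 1)^(p^(j-i) - 1), the norm
element for σ^(p^i). -/
theorem augGen_pow_sub_smul_cls (σ : K ≃ₐ[F] K) {i j : ℕ} (hij : i ≤ j) (γ γ' : Kˣ)
    (h : (γ' : K) = partialNorm (σ ^ p ^ i) (p ^ (j - i)) γ) :
    augGen p σ ^ (p ^ j - p ^ i) • cls p γ = cls p γ' := by
  rw [← augGen_pow_pred_smul_cls (σ ^ p ^ i) (j - i) γ γ' h, ← augGen_pow, ← pow_mul,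
    Nat.mul_sub, ← pow_add, Nat.add_sub_cancel' hij, mul_one]

section

variable [FiniteDimensional F K] {σ : K ≃ₐ[F] K}
  (hσ : ∀ τ : K ≃ₐ[F] K, τ ∈ Subgroup.zpowers σ)

include hσ

theorem adjoin_augGen : Algebra.adjoin (ZMod p) {augGen p σ} = ⊤ := by
  have hof : ∀ τ : K ≃ₐ[F] K, MonoidAlgebra.of (ZMod p) (K ≃ₐ[F] K) τ ∈
      Algebra.adjoin (ZMod p) {augGen p σ} := by
    intro τ
    obtain ⟨j, rfl⟩ := mem_powers_iff_mem_zpowers.2 (hσ τ)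
    simp only [map_pow]
    refine pow_mem ?_ j
    rw [show MonoidAlgebra.of (ZMod p) (K ≃ₐ[F] K) σ = augGen p σ + 1 by simp [augGen]]
    exact add_mem (Algebra.subset_adjoin rfl) (one_mem _)
  rw [eq_top_iff]
  intro a _
  induction a using MonoidAlgebra.induction_on with
  | of τ => exact hof τ
  | add a b ha hb => exact add_mem (ha trivial) (hb trivial)
  | smul r a ha => exact Subalgebra.smul_mem _ (ha trivial) r

theorem exists_eq_mul_augGen (τ : K ≃ₐ[F] K) : ∃ a : MonoidAlgebra (ZMod p) (K ≃ₐ[F] K),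
    MonoidAlgebra.of (ZMod p) (K ≃ₐ[F] K) τ - 1 = a * augGen p σ := by
  obtain ⟨j, rfl⟩ := mem_powers_iff_mem_zpowers.2 (hσ τ)
  exact ⟨_, by simp only [map_pow]; exact (geom_sum_mul _ j).symm⟩

theorem galRep_sub_mem {W : Submodule (MonoidAlgebra (ZMod p) (K ≃ₐ[F] K)) (J p K)} {x : J p K}
    (hx : augGen p σ • x ∈ W) (τ : K ≃ₐ[F] K) : galRep p τ x - x ∈ W := by
  obtain ⟨a, ha⟩ := exists_eq_mul_augGen (p := p) hσ τ
  have h : galRep p τ x - x = a • augGen p σ • x := by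
    rw [smul_smul, ← ha, sub_smul, of_smul, one_smul]
  rw [h]
  exact W.smul_mem a hx

/-- `[K_iˣ]` as an `𝔽_p[G]`-submodule of `J(K)`. -/
noncomputable def layerSubmodule (p : ℕ) [Fact p.Prime] {σ : K ≃ₐ[F] K}
    (hσ : ∀ τ : K ≃ₐ[F] K, τ ∈ Subgroup.zpowers σ) (i : ℕ) :
    Submodule (MonoidAlgebra (ZMod p) (K ≃ₐ[F] K)) (J p K) :=
  stableSubmodule (adjoin_augGen hσ) (layerClasses p σ i) (by
    intro x hx
    obtain ⟨γ, hγ, rfl⟩ := mem_layerClasses_iff.1 hx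
    have h1 := apply_mem_layer hγ 1
    rw [pow_one] at h1
    have h2 : σ γ / γ ≠ 0 := div_ne_zero (EmbeddingLike.map_ne_zero_iff.2 γ.ne_zero) γ.ne_zero
    rw [augGen_smul_cls σ γ (Units.mk0 _ h2) rfl]
    exact mem_layerClasses_iff.2 ⟨_, div_mem h1 hγ, rfl⟩)

theorem mem_layerSubmodule {i : ℕ} {x : J p K} :
    x ∈ layerSubmodule p hσ i ↔ ∃ γ : Kˣ, (γ : K) ∈ layer p σ i ∧ cls p γ = x :=
  mem_layerClasses_iff

theorem layerSubmodule_mono : Monotone (layerSubmodule p hσ) := by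
  intro i j hij x hx
  obtain ⟨γ, hγ, rfl⟩ := (mem_layerSubmodule hσ).1 hx
  exact (mem_layerSubmodule hσ).2 ⟨γ, layer_mono hij hγ, rfl⟩

theorem augGen_pow_smul_of_mem_layer {i : ℕ} {x : J p K} (hx : x ∈ layerSubmodule p hσ i) :
    augGen p σ ^ p ^ i • x = 0 := by
  obtain ⟨γ, hγ, rfl⟩ := (mem_layerSubmodule hσ).1 hx
  rw [augGen_pow, augGen_smul_cls _ γ 1 (by
    rw [mem_layer_iff.1 hγ, div_self γ.ne_zero]; rfl), cls_one]

theorem augGen_pow_sub_smul_mem {i j : ℕ} (hij : i ≤ j) {x : J p K}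
    (hx : x ∈ layerSubmodule p hσ j) :
    augGen p σ ^ (p ^ j - p ^ i) • x ∈ layerSubmodule p hσ i := by
  obtain ⟨γ, hγ, rfl⟩ := (mem_layerSubmodule hσ).1 hx
  have h0 := partialNorm_ne_zero (σ ^ p ^ i) (p ^ (j - i)) γ.ne_zero
  rw [augGen_pow_sub_smul_cls σ hij γ (Units.mk0 _ h0) rfl]
  exact (mem_layerSubmodule hσ).2 ⟨_, partialNorm_mem_layer hij hγ, rfl⟩

end

section

variable [FiniteDimensional F K] {σ : K ≃ₐ[F] K}
  (hσ : ∀ τ : K ≃ₐ[F] K, τ ∈ Subgroup.zpowers σ) (hcard : Nat.card (K ≃ₐ[F] K) = p ^ n)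

include hσ hcard

theorem layerSubmodule_top : layerSubmodule p hσ n = ⊤ := by
  refine eq_top_iff.2 fun x _ => ?_
  obtain ⟨γ, rfl⟩ := cls_surjective p x
  exact (mem_layerSubmodule hσ).2 ⟨γ, mem_layer_top hcard _, rfl⟩

variable [IsGalois F K]

/-- For γ in K_i the norm to F is the p^(n-i)th power of its norm from K_i, and n - i ≥ 1. -/
theorem normMap_eq_zero_of_mem_layer {i : ℕ} (hi : i < n) {x : J p K}
    (hx : x ∈ layerSubmodule p hσ i) : normMap p F K x = 0 := by
  obtain ⟨γ, hγ, rfl⟩ := (mem_layerSubmodule hσ).1 hx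
  rw [normMap_cls, cls_eq_zero_iff]
  have h1 : Algebra.norm F (γ : K) = Algebra.norm F (⟨γ, hγ⟩ : layer p σ i) ^ p ^ (n - i) := by
    apply (algebraMap F K).injective
    rw [map_pow, coe_norm_layer hσ hcard hi.le, algebraMap_norm_eq_partialNorm hσ, hcard,
      ← Nat.add_sub_cancel' hi.le, pow_add, Nat.add_sub_cancel_left, ← partialNorm_partialNorm,
      partialNorm_of_fixed]
    exact mem_layer_iff.1 (prod_mem fun l _ => apply_mem_layer hγ l)
  have h0 : Algebra.norm F (⟨γ, hγ⟩ : layer p σ i) ≠ 0 := by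
    rw [Algebra.norm_ne_zero_iff]
    exact fun h => γ.ne_zero (congrArg Subtype.val h)
  refine ⟨Units.mk0 _ h0 ^ p ^ (n - i - 1), ?_⟩
  ext
  rw [← pow_mul, ← pow_succ, show n - i - 1 + 1 = n - i by omega]
  exact h1.symm

theorem normClasses_eq_normImage {i : ℕ} (hi : i ≤ n) :
    normClasses p σ i = normImage (ZMod p) (augGen p σ) p i (layerSubmodule p hσ i) := by
  have key : ∀ (a : (layer p σ i)ˣ), cls p (((Units.map (algebraMap F K : F →* K)).comp
      (Units.map (Algebra.norm F : layer p σ i →* F))) a) =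
      augGen p σ ^ (p ^ i - 1) • cls p (Units.map ((layer p σ i).val : layer p σ i →* K) a) := by
    intro a
    refine (augGen_pow_pred_smul_cls σ i _ _ ?_).symm
    exact coe_norm_layer hσ hcard hi a
  ext x
  rw [normClasses, mem_classes, mem_normImage]
  constructor
  · rintro ⟨a, rfl⟩
    exact ⟨_, (mem_classes p _ _).2 ⟨a, rfl⟩, (key a).symm⟩
  · rintro ⟨w, hw, rfl⟩
    obtain ⟨a, rfl⟩ := (mem_classes p _ _).1 hw
    exact ⟨a, key a⟩

end

end ClassGroup

/-! ### Kummer theory, the kernel of the norm, and exceptional elements -/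

section Kummer

variable {p n : ℕ} [Fact p.Prime] {F : Type u} {K : Type v} [Field F] [Field K] [Algebra F K]
  [FiniteDimensional F K] [IsGalois F K] {σ : K ≃ₐ[F] K}
  (hσ : ∀ τ : K ≃ₐ[F] K, τ ∈ Subgroup.zpowers σ)

include hσ

/-- As d is not a pth power in F, σb/b is a primitive pth root of unity. So σa/a is a power
(σb/b)^s, and a/b^s is fixed by σ. -/
theorem exists_eq_pow_mul_pow {f d : F} {a b : K}
    (ha0 : a ≠ 0) (hb0 : b ≠ 0) (ha : a ^ p = algebraMap F K f) (hb : b ^ p = algebraMap F K d)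
    (hd : ∀ g : F, g ^ p ≠ d) : ∃ (s : ℕ) (g : F), f = d ^ s * g ^ p := by
  have hroot : ∀ (c : K) (e : F), c ≠ 0 → c ^ p = algebraMap F K e → (σ c / c) ^ p = 1 := by
    intro c e hc0 hc
    rw [div_pow, ← map_pow, hc, AlgEquiv.commutes, ← hc, div_self (pow_ne_zero _ hc0)]
  have hb1 : σ b / b ≠ 1 := by
    intro h1
    obtain ⟨g, hg⟩ := mem_range_algebraMap_of_fixed hσ ((div_eq_one_iff_eq hb0).1 h1)
    refine hd g ((algebraMap F K).injective ?_)
    rw [map_pow, hg, hb]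
  have hprim : IsPrimitiveRoot (σ b / b) p := by
    have := IsPrimitiveRoot.orderOf (σ b / b)
    rwa [orderOf_eq_prime (hroot b d hb0 hb) hb1] at this
  have : NeZero p := ⟨(Fact.out : p.Prime).ne_zero⟩
  obtain ⟨s, -, hs⟩ := hprim.eq_pow_of_pow_eq_one (hroot a f ha0 ha)
  have hσa : σ a = (σ b / b) ^ s * a := by rw [hs, div_mul_cancel₀ _ ha0]
  have hσb : σ b ≠ 0 := EmbeddingLike.map_ne_zero_iff.2 hb0
  obtain ⟨g, hg⟩ := mem_range_algebraMap_of_fixed hσ (x := a / b ^ s) (by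
    rw [map_div₀, map_pow, hσa, div_pow]
    field_simp)
  refine ⟨s, g, (algebraMap F K).injective ?_⟩
  rw [map_mul, map_pow, map_pow, hg, ← hb, ← ha, div_pow, ← pow_mul, ← pow_mul, mul_comm p s,
    mul_div_cancel₀ _ (pow_ne_zero _ hb0)]

variable (hcard : Nat.card (K ≃ₐ[F] K) = p ^ n)

include hcard

/-- The kernel of the norm `[K_{i+1}ˣ] → J(K)`. -/
theorem exists_eq_add_of_augGen_pow_smul_eq_zero {δ : Kˣ}
    (hδ : normMap p F K (cls p δ) ≠ 0) (hδ' : augGen p σ ^ (p ^ n - 1) • cls p δ = 0)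
    {i : ℕ} (hi : i + 1 ≤ n) {x : J p K} (hx : x ∈ layerSubmodule p hσ (i + 1))
    (hx' : augGen p σ ^ (p ^ (i + 1) - 1) • x = 0) :
    ∃ y ∈ layerSubmodule p hσ i, ∃ z ∈ layerSubmodule p hσ (i + 1), ∃ s : ℕ,
      x = y + augGen p σ • z + s • augGen p σ ^ (p ^ n - p ^ (i + 1)) • cls p δ := by
  obtain ⟨u, hu, rfl⟩ := (mem_layerSubmodule hσ).1 hx
  obtain ⟨f, hf⟩ := mem_range_algebraMap_of_fixed hσ (x := partialNorm σ (p ^ (i + 1)) (u : K)) (by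
    have := apply_partialNorm_mul σ (p ^ (i + 1)) (u : K)
    rw [mem_layer_iff.1 hu] at this
    exact mul_right_cancel₀ u.ne_zero this)
  have hNδ : partialNorm σ (p ^ n) (δ : K) = algebraMap F K (Algebra.norm F (δ : K)) := by
    rw [algebraMap_norm_eq_partialNorm hσ, hcard]
  have hcls : ∀ (j : ℕ) (γ : Kˣ), augGen p σ ^ (p ^ j - 1) • cls p γ = 0 →
      ∃ a : K, a ≠ 0 ∧ a ^ p = partialNorm σ (p ^ j) (γ : K) := by
    intro j γ h0
    rw [augGen_pow_pred_smul_cls σ j γ (Units.mk0 _ (partialNorm_ne_zero σ (p ^ j) γ.ne_zero)) rfl,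
      cls_eq_zero_iff] at h0
    obtain ⟨a, ha⟩ := h0
    exact ⟨a, a.ne_zero, by rw [← Units.val_pow_eq_pow_val, ha]; rfl⟩
  obtain ⟨a, ha0, ha⟩ := hcls _ _ hx'
  obtain ⟨b, hb0, hb⟩ := hcls _ _ hδ'
  -- The norm of u is a pth power in K, though perhaps not in F. So is the norm of δ, which is not
  -- one in F, so the two agree up to an exponent s and a pth power.
  obtain ⟨s, g, hsg⟩ := exists_eq_pow_mul_pow hσ ha0 hb0 (ha.trans hf.symm) (hb.trans hNδ) (by
    intro g hg
    refine hδ ((cls_eq_zero_iff p _).2 ?_)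
    have hg0 : g ≠ 0 := by
      rintro rfl
      rw [zero_pow (Fact.out : p.Prime).ne_zero] at hg
      exact δ.ne_zero (Algebra.norm_eq_zero_iff.1 hg.symm)
    exact ⟨Units.mk0 g hg0, Units.ext hg⟩)
  -- The norm of δ down to K_{i+1} has the same norm to F as δ, so u/e^s lies in K_{i+1} and its
  -- norm is a pth power in F.
  set e := partialNorm (σ ^ p ^ (i + 1)) (p ^ (n - (i + 1))) (δ : K) with he
  have he0 : e ≠ 0 := partialNorm_ne_zero _ _ δ.ne_zero
  have hNe : partialNorm σ (p ^ (i + 1)) e = algebraMap F K (Algebra.norm F (δ : K)) := by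
    rw [he, partialNorm_pow_partialNorm, ← pow_add, Nat.add_sub_cancel' hi, hNδ]
  have hmem : e ∈ layer p σ (i + 1) := partialNorm_mem_layer hi (mem_layer_top hcard _)
  have hd0 : Algebra.norm F (δ : K) ≠ 0 := Algebra.norm_ne_zero_iff.2 δ.ne_zero
  obtain ⟨z, hz, ω, hω, hz0, hω0, heq⟩ := exists_mul_apply_div_of_partialNorm_eq_pow hσ hcard hi
    (div_ne_zero u.ne_zero (pow_ne_zero s he0)) (div_mem hu (pow_mem hmem s)) (f := g) (by
      rw [partialNorm_div, partialNorm_pow, hNe, ← hf, hsg, map_mul, map_pow, map_pow,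
        mul_div_cancel_left₀]
      exact pow_ne_zero _ (by simp [δ.ne_zero]))
  have hσω : σ ω / ω ≠ 0 := div_ne_zero (EmbeddingLike.map_ne_zero_iff.2 hω0) hω0
  refine ⟨cls p (Units.mk0 z hz0), (mem_layerSubmodule hσ).2 ⟨_, hz, rfl⟩,
    cls p (Units.mk0 ω hω0), (mem_layerSubmodule hσ).2 ⟨_, hω, rfl⟩, s, ?_⟩
  rw [augGen_pow_sub_smul_cls σ hi δ (Units.mk0 e he0) rfl,
    augGen_smul_cls σ (Units.mk0 ω hω0) (Units.mk0 _ hσω) rfl, ← cls_pow, ← cls_mul, ← cls_mul]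
  congr 1
  ext
  simp only [Units.val_mul, Units.val_pow_eq_pow_val, Units.val_mk0]
  rw [← heq, div_mul_cancel₀ _ (pow_ne_zero s he0)]

/-- Otherwise α = z · σω/ω with z in K_{n-1}. With τ = σ^(p^(n-1)), the element c = τω/ω satisfies
σc = ξc and has τ-norm 1. That norm is also c^p times a power of ξ with exponent p^(n-1) · p(p-1)/2,
divisible by p unless p = 2 and n = 1. Hence c is a pth root of unity, so it is fixed by σ,
contradicting ξ ≠ 1. -/
theorem normMap_ne_zero_of_apply_eq {ξ : F} (hξ : IsPrimitiveRoot ξ p) (hn : 1 ≤ n)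
    (hpn : ¬(p = 2 ∧ n = 1)) {α : Kˣ} (hα : (σ ^ p ^ (n - 1)) (α : K) = algebraMap F K ξ * α) :
    normMap p F K (cls p α) ≠ 0 := by
  intro h0
  have hp := (Fact.out : p.Prime)
  rw [normMap_cls, cls_eq_zero_iff] at h0
  obtain ⟨f, hf⟩ := h0
  obtain ⟨z, hz, ω, -, hz0, hω0, heq⟩ := exists_mul_apply_div_of_partialNorm_eq_pow hσ hcard
    (i := n - 1) (by omega) α.ne_zero (by rw [Nat.sub_add_cancel hn]; exact mem_layer_top hcard _)
    (f := f) (by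
      rw [Nat.sub_add_cancel hn, ← map_pow, ← Units.val_pow_eq_pow_val, hf, ← hcard,
        ← algebraMap_norm_eq_partialNorm hσ]
      rfl)
  set τ := σ ^ p ^ (n - 1) with hτ
  set c := τ ω / ω with hc
  have hτω : τ ω ≠ 0 := EmbeddingLike.map_ne_zero_iff.2 hω0
  have hc0 : c ≠ 0 := div_ne_zero hτω hω0
  have hσω : σ ω ≠ 0 := EmbeddingLike.map_ne_zero_iff.2 hω0
  have hcomm : σ (τ ω) = τ (σ ω) := by
    rw [hτ, ← AlgEquiv.mul_apply, ← AlgEquiv.mul_apply, ← pow_succ, ← pow_succ']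
  have hτσω : τ (σ ω) ≠ 0 := EmbeddingLike.map_ne_zero_iff.2 hσω
  have hσc : σ c = algebraMap F K ξ * c := by
    have h1 := hα
    rw [heq, map_mul, mem_layer_iff.1 hz, map_div₀] at h1
    rw [hc, map_div₀, hcomm]
    field_simp at h1 ⊢
    exact h1
  have hσpow : ∀ j : ℕ, (σ ^ j) c = algebraMap F K ξ ^ j * c := by
    intro j
    induction j with
    | zero => simp
    | succ j ih =>
      rw [pow_succ, AlgEquiv.mul_apply, hσc, map_mul, AlgEquiv.commutes, ih, pow_succ]
      ring
  have hnorm : partialNorm τ p c = 1 := by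
    rw [hc, partialNorm_apply_div _ _ hω0, hτ, ← pow_mul, ← pow_succ, Nat.sub_add_cancel hn,
      pow_prime_pow_eq_one hcard]
    exact div_self hω0
  have hnorm' : partialNorm τ p c = c ^ p := by
    have h1 : ∀ l, (τ ^ l) c = (algebraMap F K ξ ^ p ^ (n - 1)) ^ l * c := by
      intro l
      rw [hτ, ← pow_mul, hσpow, pow_mul]
    have h2 : algebraMap F K ξ ^ (p ^ (n - 1) * ∑ l ∈ Finset.range p, l) = 1 := by
      have hdvd : p ∣ p ^ (n - 1) * ∑ l ∈ Finset.range p, l := by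
        by_cases hn1 : n = 1
        · refine Dvd.dvd.mul_left ?_ _
          rw [Finset.sum_range_id]
          obtain ⟨r, hr⟩ := hp.eq_two_or_odd'.resolve_left fun h => hpn ⟨h, hn1⟩
          refine ⟨r, ?_⟩
          rw [Nat.div_eq_of_eq_mul_left two_pos]
          rw [mul_assoc, hr]
          congr 1
          omega
        · exact Dvd.dvd.mul_right (dvd_pow_self p (by omega)) _
      obtain ⟨r, hr⟩ := hdvd
      rw [hr, pow_mul, ← map_pow, hξ.pow_eq_one, map_one, one_pow]
    simp only [partialNorm, h1]
    rw [Finset.prod_mul_distrib, Finset.prod_pow_eq_pow_sum, ← pow_mul, h2]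
    simp
  have : NeZero p := ⟨hp.ne_zero⟩
  obtain ⟨r, -, hr⟩ := (hξ.map_of_injective (algebraMap F K).injective).eq_pow_of_pow_eq_one
    (hnorm'.symm.trans hnorm)
  have hσc' : σ c = c := by rw [← hr, ← map_pow, AlgEquiv.commutes]
  rw [hσc', eq_comm] at hσc
  refine hξ.ne_one hp.one_lt ((algebraMap F K).injective ?_)
  rw [map_one]
  exact mul_right_cancel₀ hc0 (hσc.trans (one_mul c).symm)

/-- As k² has norm 1, Hilbert 90 gives γ with σγ = k²γ, so [γ] is fixed. Its norm is (γk)²; were it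
a square in F, γk would lie in F, but σ(γk) = -γk and the characteristic is not 2. -/
theorem exists_exceptional_of_norm_eq_neg_one {ξ : F} (hξ : IsPrimitiveRoot ξ p) (hp2 : p = 2)
    (hn : n = 1) {k : K} (hk : Algebra.norm F k = -1) :
    ∃ γ : Kˣ, normMap p F K (cls p γ) ≠ 0 ∧ augGen p σ • cls p γ = 0 := by
  subst hp2 hn
  have hk0 : k ≠ 0 := by
    rintro rfl
    simp at hk
  have hξ' : ξ = -1 := hξ.eq_neg_one_of_two_right
  have h2 : (2 : K) ≠ 0 := by
    intro h2
    have h3 : (-1 : F) ≠ 1 := hξ' ▸ hξ.ne_one one_lt_two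
    apply h3
    apply (algebraMap F K).injective
    rw [map_neg, map_one]
    linear_combination -h2
  have hN : ∀ x : K, algebraMap F K (Algebra.norm F x) = x * σ x := by
    intro x
    rw [algebraMap_norm_eq_partialNorm hσ, hcard]
    simp [partialNorm, Finset.prod_range_succ]
  have hkk : k * σ k = -1 := by rw [← hN, hk]; simp
  obtain ⟨γ, -, hγ0, hγ⟩ := exists_apply_eq_mul hσ hcard (Nat.zero_le 1) le_rfl
    (mem_layer_top hcard (k ^ 2)) (by
      simp only [partialNorm, pow_zero, pow_one, Nat.sub_zero, Finset.prod_range_succ,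
        Finset.prod_range_zero, one_mul, AlgEquiv.one_apply, map_pow]
      rw [← mul_pow, hkk]
      norm_num)
  rw [pow_zero, pow_one] at hγ
  refine ⟨Units.mk0 γ hγ0, ?_, ?_⟩
  · intro h0
    rw [normMap_cls, cls_eq_zero_iff] at h0
    obtain ⟨f, hf⟩ := h0
    have h1 : algebraMap F K f ^ 2 = (γ * k) ^ 2 := by
      rw [← map_pow, ← Units.val_pow_eq_pow_val, hf]
      change algebraMap F K (Algebra.norm F γ) = _
      rw [hN, hγ]
      ring
    have hfix : σ (γ * k) = γ * k := by
      rcases sq_eq_sq_iff_eq_or_eq_neg.1 h1 with h | h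
      · rw [← h, AlgEquiv.commutes]
      · rw [← neg_eq_iff_eq_neg.2 h, map_neg, AlgEquiv.commutes]
    have h4 : γ * k * 2 = 0 := by
      rw [map_mul, hγ] at hfix
      linear_combination (-1 : K) * hfix + k * γ * hkk
    exact mul_ne_zero (mul_ne_zero hγ0 hk0) h2 h4
  · rw [augGen_smul_cls σ _ (Units.mk0 k hk0 ^ 2) (by
      simp only [Units.val_pow_eq_pow_val, Units.val_mk0]
      rw [hγ, mul_div_cancel_right₀ _ hγ0]), cls_eq_zero_iff]
    exact ⟨_, rfl⟩

end Kummer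

/-- The least index `μ` with `m < μ`. -/
def succIndex (m : WithBot ℕ) : ℕ := WithBot.recBotCoe (C := fun _ => ℕ) 0 (fun j => j + 1) m

theorem shiftedPow_succIndex (p : ℕ) (m : WithBot ℕ) : shiftedPow p (succIndex m) = powBot p m := by
  induction m using WithBot.recBotCoe <;> rfl

theorem succIndex_le_succ_iff {m : WithBot ℕ} {i : ℕ} :
    succIndex m ≤ i + 1 ↔ m ≤ (i : WithBot ℕ) := by
  induction m using WithBot.recBotCoe with
  | bot => simp [succIndex]
  | coe k => exact (Nat.succ_le_succ_iff).trans WithBot.coe_le_coe.symm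

theorem lt_succIndex_iff {m : WithBot ℕ} {i : ℕ} : i < succIndex m ↔ (i : WithBot ℕ) ≤ m := by
  induction m using WithBot.recBotCoe with
  | bot => simp [succIndex]
  | coe k => exact (Nat.lt_succ_iff).trans WithBot.coe_le_coe.symm

theorem succIndex_eq_succ_iff {m : WithBot ℕ} {i : ℕ} :
    succIndex m = i + 1 ↔ (i : WithBot ℕ) = m := by
  rw [eq_comm (b := m), le_antisymm_iff, succIndex_le_succ_iff, Nat.succ_le_iff, lt_succIndex_iff,
    ← le_antisymm_iff]

/-! ### Bounds and minimality for the exceptional index -/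

section ExceptionalIndex

variable {p n : ℕ} [Fact p.Prime] {F : Type u} {K : Type v} [Field F] [Field K] [Algebra F K]
  [FiniteDimensional F K] {σ : K ≃ₐ[F] K}
  (hσ : ∀ τ : K ≃ₐ[F] K, τ ∈ Subgroup.zpowers σ)

include hσ

theorem isExceptionalAt_coe_iff (i : ℕ) (δ : Kˣ) : IsExceptionalAt p σ (i : WithBot ℕ) δ ↔
    normMap p F K (cls p δ) ≠ 0 ∧ augGen p σ • cls p δ ∈ layerSubmodule p hσ i := by
  rw [IsExceptionalAt, cls_one, ← normMap_cls]
  refine and_congr Iff.rfl ⟨fun h => ?_, fun h τ => galRep_sub_mem hσ h τ⟩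
  rw [augGen_smul]
  exact h σ

theorem isExceptionalAt_bot_iff (δ : Kˣ) : IsExceptionalAt p σ ⊥ δ ↔
    normMap p F K (cls p δ) ≠ 0 ∧ augGen p σ • cls p δ = 0 := by
  rw [IsExceptionalAt, cls_one, ← normMap_cls]
  refine and_congr Iff.rfl ⟨fun h => ?_, fun h τ => ?_⟩
  · rw [augGen_smul]
    exact (Submodule.mem_bot _).1 (h σ)
  · have := galRep_sub_mem hσ (W := ⊥) ((Submodule.mem_bot _).2 h) τ
    exact (Submodule.mem_bot _).2 ((Submodule.mem_bot _).1 this)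

variable [IsGalois F K] (hcard : Nat.card (K ≃ₐ[F] K) = p ^ n) (hn : 1 ≤ n)
  (hξ : ∃ ξ : F, IsPrimitiveRoot ξ p) (hp2 : p = 2 → 1 < n ∨ ∃ k : K, Algebra.norm F k = -1)
  {m : WithBot ℕ} (hm : IsLeast (exceptionalIndices p n σ) m)

include hcard hn hξ hp2 hm

theorem exceptionalIndex_lt : m = ⊥ ∨ ∃ j : ℕ, m = j ∧ j < n ∧ ¬(p = 2 ∧ n = 1) := by
  obtain ⟨ξ, hξ⟩ := hξ
  by_cases hpn : p = 2 ∧ n = 1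
  · left
    obtain ⟨k, hk⟩ := (hp2 hpn.1).resolve_left (by omega)
    obtain ⟨γ, hγ⟩ := exists_exceptional_of_norm_eq_neg_one hσ hcard hξ hpn.1 hpn.2 hk
    exact le_bot_iff.1 (hm.2 ⟨bot_le, γ, (isExceptionalAt_bot_iff hσ γ).2 hγ⟩)
  · have hp := (Fact.out : p.Prime).pos
    -- A Kummer generator α of K/K_{n-1} witnesses m ≤ n - 1: σ^(p^(n-1)) scales α and σα by the
    -- same ξ, so σα/α lies in K_{n-1}.
    obtain ⟨α, -, hα0, hα⟩ := exists_apply_eq_mul hσ hcard (l := n - 1) (Nat.sub_le n 1) le_rfl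
      (IntermediateField.algebraMap_mem _ ξ) (by
        rw [partialNorm_of_fixed _ _ (AlgEquiv.commutes _ ξ), show n - (n - 1) = 1 by omega,
          pow_one, ← map_pow, hξ.pow_eq_one, map_one])
    have hσα : σ α ≠ 0 := EmbeddingLike.map_ne_zero_iff.2 hα0
    have hex : IsExceptionalAt p σ ((n - 1 : ℕ) : WithBot ℕ) (Units.mk0 α hα0) := by
      rw [isExceptionalAt_coe_iff hσ]
      refine ⟨normMap_ne_zero_of_apply_eq hσ hcard hξ hn hpn hα, ?_⟩
      rw [augGen_smul_cls σ _ (Units.mk0 _ (div_ne_zero hσα hα0)) rfl]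
      refine (mem_layerSubmodule hσ).2 ⟨_, ?_, rfl⟩
      rw [mem_layer_iff]
      change (σ ^ p ^ (n - 1)) (σ α / α) = σ α / α
      have hα' : (σ ^ p ^ (n - 1)) (σ α) = σ ((σ ^ p ^ (n - 1)) α) := by
        rw [← AlgEquiv.mul_apply, ← AlgEquiv.mul_apply, ← pow_succ, ← pow_succ']
      have hξ0 : algebraMap F K ξ ≠ 0 := by
        simpa using hξ.ne_zero (Fact.out : p.Prime).ne_zero
      rw [map_div₀, hα', hα, map_mul, AlgEquiv.commutes, mul_div_mul_left _ _ hξ0]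
    have hle : m ≤ ((n - 1 : ℕ) : WithBot ℕ) :=
      hm.2 ⟨WithBot.coe_le_coe.2 (Nat.sub_le n 1), _, hex⟩
    induction m using WithBot.recBotCoe with
    | bot => exact Or.inl rfl
    | coe j => exact Or.inr ⟨j, rfl, by have := WithBot.coe_le_coe.1 hle; simp at this; omega, hpn⟩

variable {δ : Kˣ} (hδ : IsExceptionalAt p σ m δ)

include hδ

/-- From such an x, the class δ' = [δ] - t^e x with e = p^(m+1) - p^m - 1 has the same norm class as
[δ], and tδ' in U_m has norm class zero. The kernel fact writes tδ' = y + tz with y in U_{m-1}, so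
δ' - z is exceptional at m - 1. For m = 0 one gets tδ' = 0 directly, and for m = -∞ the class [δ]
would come from F and have trivial norm. -/
theorem socle_notMem_of_isLeast (hker : ∀ i, i + 1 < n → ∀ x ∈ layerSubmodule p hσ (i + 1),
    augGen p σ ^ (p ^ (i + 1) - 1) • x = 0 →
    ∃ y ∈ layerSubmodule p hσ i, ∃ z ∈ layerSubmodule p hσ (i + 1), x = y + augGen p σ • z)
    {x : J p K} (hx : x ∈ layerSubmodule p hσ (succIndex m)) :
    augGen p σ ^ (p ^ succIndex m - 1) • x ≠ augGen p σ ^ powBot p m • cls p δ := by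
  intro heq
  have hp := (Fact.out : p.Prime).two_le
  rcases exceptionalIndex_lt hσ hcard hn hξ hp2 hm with rfl | ⟨j, rfl, hj, hpn⟩
  · change augGen p σ ^ (p ^ 0 - 1) • x = augGen p σ ^ 0 • cls p δ at heq
    rw [pow_zero, Nat.sub_self, pow_zero, one_smul, one_smul] at heq
    subst heq
    exact ((isExceptionalAt_bot_iff hσ δ).1 hδ).1 (normMap_eq_zero_of_mem_layer hσ hcard hn hx)
  · change x ∈ layerSubmodule p hσ (j + 1) at hx
    change augGen p σ ^ (p ^ (j + 1) - 1) • x = augGen p σ ^ p ^ j • cls p δ at heq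
    obtain ⟨hδ1, hδ2⟩ := (isExceptionalAt_coe_iff hσ j δ).1 hδ
    have h1 : 1 ≤ p ^ j := Nat.one_le_pow _ _ (by omega)
    have h2 : p ^ j < p ^ (j + 1) := Nat.pow_lt_pow_right hp (by omega)
    set e := p ^ (j + 1) - p ^ j - 1 with he
    have hnorm : normMap p F K (augGen p σ ^ e • x) = 0 := by
      -- For e > 0 the term is a multiple of t, so its norm class vanishes. If e = 0 then p = 2 and
      -- m = 0, where n > 1 leaves x in a proper layer.
      rcases Nat.eq_zero_or_pos e with he0 | he0
      · rw [he0, pow_zero, one_smul]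
        refine normMap_eq_zero_of_mem_layer hσ hcard (lt_of_le_of_ne hj ?_) hx
        intro hjn
        apply hpn
        have h3 : p ^ (j + 1) = p ^ j + 1 := by omega
        have h4 : p ^ j * (p - 1) = 1 := by
          rw [Nat.mul_sub, ← pow_succ, h3, mul_one]
          omega
        have h5 := Nat.dvd_one.1 (Dvd.intro _ h4)
        have h6 := Nat.dvd_one.1 (Dvd.intro_left _ h4)
        have h7 : j = 0 := by
          rcases Nat.pow_eq_one.1 h5 with h | h
          · omega
          · exact h
        omega
      · rw [show e = 1 + (e - 1) by omega, pow_add, pow_one, mul_smul]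
        exact normMap_augGen_smul σ _
    set w := augGen p σ • (cls p δ - augGen p σ ^ e • x) with hw
    have hw' : w = augGen p σ • cls p δ - augGen p σ ^ (p ^ (j + 1) - p ^ j) • x := by
      rw [hw, smul_sub, smul_smul, ← pow_succ', show e + 1 = p ^ (j + 1) - p ^ j by omega]
    have hwmem : w ∈ layerSubmodule p hσ j := by
      rw [hw']
      exact Submodule.sub_mem _ hδ2 (augGen_pow_sub_smul_mem hσ (Nat.le_succ j) hx)
    have hwker : augGen p σ ^ (p ^ j - 1) • w = 0 := by
      rw [hw', smul_sub, smul_smul, smul_smul, ← pow_succ, ← pow_add, Nat.sub_add_cancel h1,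
        show p ^ j - 1 + (p ^ (j + 1) - p ^ j) = p ^ (j + 1) - 1 by omega, heq, sub_self]
    rcases j with _ | i
    · rw [pow_zero, Nat.sub_self, pow_zero, one_smul] at hwker
      obtain ⟨γ, hγ⟩ := cls_surjective p (cls p δ - augGen p σ ^ e • x)
      have := hm.2 ⟨bot_le, γ, (isExceptionalAt_bot_iff hσ γ).2
        ⟨by rwa [hγ, map_sub, hnorm, sub_zero], by rw [hγ, ← hw, hwker]⟩⟩
      simp at this
    · obtain ⟨y, hy, z, hz, hyz⟩ := hker i hj w hwmem hwker
      obtain ⟨γ, hγ⟩ := cls_surjective p (cls p δ - augGen p σ ^ e • x - z)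
      have := hm.2 ⟨WithBot.coe_le_coe.2 (show i ≤ n by omega), γ,
        (isExceptionalAt_coe_iff hσ i γ).2
        ⟨by rwa [hγ, map_sub, map_sub, hnorm, sub_zero,
          normMap_eq_zero_of_mem_layer hσ hcard hj hz, sub_zero],
          by rwa [hγ, smul_sub, ← hw, hyz, add_sub_cancel_right]⟩⟩
      have : i + 1 ≤ i := WithBot.coe_le_coe.1 this
      omega

theorem normFiltration : NormFiltration (ZMod p) (augGen p σ) p n (layerSubmodule p hσ) (cls p δ)
    (succIndex m) := by
  have hp := (Fact.out : p.Prime).two_le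
  have hpos : ∀ i, 1 ≤ p ^ i := fun i => Nat.one_le_pow _ _ (by omega)
  have hcases := exceptionalIndex_lt hσ hcard hn hξ hp2 hm
  have hnδ : normMap p F K (cls p δ) ≠ 0 := by
    rw [normMap_cls, ← cls_one]
    exact hδ.1
  have hle : succIndex m ≤ n := by
    rcases hcases with rfl | ⟨j, rfl, hj, -⟩
    · exact Nat.zero_le _
    · exact hj
  have hmem : ∀ j, succIndex m ≤ j + 1 → augGen p σ • cls p δ ∈ layerSubmodule p hσ j := by
    intro i hi
    rcases hcases with rfl | ⟨j, rfl, hj, -⟩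
    · rw [((isExceptionalAt_bot_iff hσ δ).1 hδ).2]
      exact Submodule.zero_mem _
    · exact layerSubmodule_mono hσ (Nat.le_of_succ_le_succ hi)
        ((isExceptionalAt_coe_iff hσ j δ).1 hδ).2
  have hzero : succIndex m = 0 → augGen p σ • cls p δ = 0 := by
    intro h0
    rcases hcases with rfl | ⟨j, rfl, hj, -⟩
    · exact ((isExceptionalAt_bot_iff hσ δ).1 hδ).2
    · exact absurd h0 (Nat.succ_ne_zero j)
  have hgap : ∀ j < n, ¬(p = 2 ∧ n = 1) → p ^ j + 2 ≤ p ^ n := by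
    intro j hj hpn
    have h1 : p ^ j ≤ p ^ (n - 1) := Nat.pow_le_pow_right (by omega) (by omega)
    have h2 : p ^ n = p ^ (n - 1) * p := by rw [← pow_succ, Nat.sub_add_cancel hn]
    rw [h2]
    rcases Nat.lt_or_ge 2 p with h3 | h3
    · have := hpos (n - 1)
      nlinarith
    · have h4 : p = 2 := by omega
      have h5 : p ^ 1 ≤ p ^ (n - 1) := Nat.pow_le_pow_right (by omega) (by omega)
      rw [h4] at h1 h5 ⊢
      omega
  have hgap' : powBot p m + 2 ≤ p ^ n := by
    rcases hcases with rfl | ⟨j, rfl, hj, hpn⟩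
    · have : p ^ 1 ≤ p ^ n := Nat.pow_le_pow_right (by omega) hn
      rw [pow_one] at this
      change 0 + 2 ≤ p ^ n
      omega
    · exact hgap j hj hpn
  have hkill : augGen p σ ^ (p ^ n - 1) • cls p δ = 0 := by
    refine pow_smul_eq_zero_of_le (l := powBot p m + 1) (by omega) ?_
    rcases hcases with rfl | ⟨j, rfl, hj, hpn⟩
    · change augGen p σ ^ (0 + 1) • cls p δ = 0
      rw [zero_add, pow_one, hzero rfl]
    · rw [pow_succ, mul_smul]
      exact augGen_pow_smul_of_mem_layer hσ (hmem j le_rfl)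
  have hker : ∀ i, i + 1 < n → ∀ x ∈ layerSubmodule p hσ (i + 1),
      augGen p σ ^ (p ^ (i + 1) - 1) • x = 0 →
      ∃ y ∈ layerSubmodule p hσ i, ∃ z ∈ layerSubmodule p hσ (i + 1),
        x = y + augGen p σ • z := by
    intro i hi x hx hx'
    obtain ⟨y, hy, z, hz, s, rfl⟩ := exists_eq_add_of_augGen_pow_smul_eq_zero hσ hcard hnδ hkill
      hi.le hx hx'
    -- Below the top the δ term is absorbed in tU_{i+1}: one factor t is kept outside, another moves
    -- δ into a layer. If that layer K_m is above K_{i+1}, the norm factor t^(p^m - p^(i+1)) brings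
    -- it down; the gap p^m + 2 ≤ p^n leaves enough powers.
    obtain ⟨w, hw, hw'⟩ : ∃ w ∈ layerSubmodule p hσ (i + 1),
        augGen p σ ^ (p ^ n - p ^ (i + 1)) • cls p δ = augGen p σ • w := by
      have hgi := hgap (i + 1) hi (by omega)
      by_cases hji : succIndex m ≤ i + 1 + 1
      · refine ⟨_, Submodule.smul_mem _ (augGen p σ ^ (p ^ n - p ^ (i + 1) - 2)) (hmem _ hji), ?_⟩
        rw [smul_smul, smul_smul, ← pow_succ', ← pow_succ]
        congr 2
        omega
      · rcases hcases with rfl | ⟨j, rfl, hj, hpn⟩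
        · exact absurd (Nat.zero_le _) hji
        · have hij : i + 1 ≤ j := by
            change ¬(j + 1 ≤ i + 1 + 1) at hji
            omega
          have hpij : p ^ (i + 1) ≤ p ^ j := Nat.pow_le_pow_right (by omega) hij
          have hgj := hgap j hj hpn
          refine ⟨_, Submodule.smul_mem _ (augGen p σ ^ (p ^ n - p ^ j - 2))
            (augGen_pow_sub_smul_mem hσ hij (hmem j le_rfl)), ?_⟩
          rw [smul_smul, smul_smul, smul_smul, ← pow_succ', ← pow_add, ← pow_succ]
          congr 2
          omega
    refine ⟨y, hy, z + s • w, Submodule.add_mem _ hz (Submodule.smul_of_tower_mem _ s hw), ?_⟩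
    rw [hw', smul_add, smul_comm s, add_assoc]
  exact
    { adjoin := adjoin_augGen hσ
      two_le := hp
      pow_eq_zero := augGen_pow_eq_zero hcard
      mono := layerSubmodule_mono hσ
      top := layerSubmodule_top hσ hcard
      pow_smul := fun i x hx => augGen_pow_smul_of_mem_layer hσ hx
      norm := fun i j hij _ x hx => augGen_pow_sub_smul_mem hσ hij hx
      ker := hker
      ker_top := by
        intro x hx
        have hn' : n - 1 + 1 = n := Nat.sub_add_cancel hn
        obtain ⟨y, hy, z, -, s, hs⟩ := exists_eq_add_of_augGen_pow_smul_eq_zero hσ hcard hnδ hkill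
          (i := n - 1) hn'.le (x := x) (by rw [hn', layerSubmodule_top hσ hcard]; trivial)
          (by rwa [hn'])
        refine ⟨y, hy, z, (s : MonoidAlgebra (ZMod p) (K ≃ₐ[F] K)), ?_⟩
        rw [hs, hn', Nat.sub_self, pow_zero, one_smul, Nat.cast_smul_eq_nsmul]
      le := hle
      pos := hn
      add_two_le := by rwa [shiftedPow_succIndex]
      smul_mem := hmem
      smul_eq_zero := hzero
      notMem := by
        intro x hx
        rw [shiftedPow_succIndex]
        exact socle_notMem_of_isLeast hσ hcard hn hξ hp2 hm hδ hker hx }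

end ExceptionalIndex

/-! ### Fixed vectors as annihilators of powers of t -/

section FixedParts

variable {p n : ℕ} {F : Type u} {K : Type v} [Field F] [Field K] [Algebra F K]

theorem forall_zpowers_galRep_eq_iff (g : K ≃ₐ[F] K) (x : J p K) :
    (∀ τ ∈ Subgroup.zpowers g, galRep p τ x = x) ↔ augGen p g • x = 0 := by
  rw [augGen_smul, sub_eq_zero]
  constructor
  · exact fun h => h g (Subgroup.mem_zpowers g)
  · intro h τ hτ
    let S : Subgroup (K ≃ₐ[F] K) :=
      { carrier := {τ | galRep p τ x = x}
        one_mem' := by simp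
        mul_mem' := fun {a b} ha hb => by
          change galRep p (a * b) x = x
          rw [map_mul, Module.End.mul_apply, hb, ha]
        inv_mem' := fun {a} ha => by
          change galRep p a⁻¹ x = x
          conv_lhs => rw [← show galRep p a x = x from ha]
          rw [← Module.End.mul_apply, ← map_mul, inv_mul_cancel, map_one, Module.End.one_apply] }
    have hle : Subgroup.zpowers g ≤ S := by
      rw [Subgroup.zpowers_le]
      exact h
    exact hle hτ

theorem mem_fixedPart_layerGroup_iff [Fact p.Prime] {σ : K ≃ₐ[F] K} {i : ℕ}
    {W : Submodule (MonoidAlgebra (ZMod p) (K ≃ₐ[F] K)) (J p K)} {x : J p K} :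
    x ∈ fixedPart p (layerGroup p σ i) W ↔ x ∈ W ∧ augGen p σ ^ p ^ i • x = 0 := by
  rw [augGen_pow]
  exact and_congr Iff.rfl (forall_zpowers_galRep_eq_iff _ x)

theorem mem_fixedPart_top_iff {σ : K ≃ₐ[F] K} (hσ : ∀ τ : K ≃ₐ[F] K, τ ∈ Subgroup.zpowers σ)
    {W : Submodule (MonoidAlgebra (ZMod p) (K ≃ₐ[F] K)) (J p K)} {x : J p K} :
    x ∈ fixedPart p ⊤ W ↔ x ∈ W ∧ augGen p σ • x = 0 := by
  rw [← (Subgroup.eq_top_iff' _).2 hσ]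
  exact and_congr Iff.rfl (forall_zpowers_galRep_eq_iff _ x)

theorem galRep_sub_one_apply (σ : K ≃ₐ[F] K) (x : J p K) :
    (galRep p σ - 1) x = augGen p σ • x := by
  rw [augGen_smul]; rfl

theorem galRep_sub_one_pow_apply (σ : K ≃ₐ[F] K) (r : ℕ) (x : J p K) :
    ((galRep p σ - 1) ^ r) x = augGen p σ ^ r • x := by
  induction r with
  | zero => simp
  | succ r ih =>
    rw [pow_succ', Module.End.mul_apply, ih, galRep_sub_one_apply, smul_smul, ← pow_succ']

end FixedParts

/-! ### Freeness over the quotient group rings -/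

section FreeQuotient

variable {p n : ℕ} [Fact p.Prime] {F : Type u} {K : Type v} [Field F] [Field K] [Algebra F K]
  [FiniteDimensional F K] {σ : K ≃ₐ[F] K}
  (hσ : ∀ τ : K ≃ₐ[F] K, τ ∈ Subgroup.zpowers σ) (hcard : Nat.card (K ≃ₐ[F] K) = p ^ n)

include hσ hcard

theorem index_layerGroup {i : ℕ} (hi : i ≤ n) : (layerGroup p σ i).index = p ^ i := by
  have hp := (Fact.out : p.Prime).pos
  have h1 := (layerGroup p σ i).card_mul_index
  have h2 : Nat.card (layerGroup p σ i) = p ^ (n - i) := by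
    rw [layerGroup, Nat.card_zpowers, orderOf_pow,
      orderOf_eq_card_of_forall_mem_zpowers hσ, hcard,
      Nat.gcd_eq_right (pow_dvd_pow p hi), Nat.pow_div hi hp]
  rw [h2, hcard, ← Nat.sub_add_cancel hi, pow_add, Nat.add_sub_cancel] at h1
  exact Nat.eq_of_mul_eq_mul_left (pow_pos hp _) h1

/-- The ring 𝔽_p[G/H_i] has dimension p^i, the dimension of each cyclic summand, so
`free_of_cyclics` applies; the number of summands is the socle dimension. -/
theorem hasFreeRank_of_isSumOfCyclics {i : ℕ} (hi : i ≤ n)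
    {W : Submodule (MonoidAlgebra (ZMod p) (K ≃ₐ[F] K)) (J p K)}
    (hW : IsSumOfCyclics p (p ^ i) W) (hkill : ∀ w ∈ W, augGen p σ ^ p ^ i • w = 0) :
    HasFreeRank p (layerGroup p σ i) W (Module.rank (ZMod p) (socle (ZMod p) (augGen p σ) W)) := by
  have hp := (Fact.out : p.Prime).pos
  have hcomm : ∀ a b : K ≃ₐ[F] K, a * b = b * a := by
    intro a b
    obtain ⟨j, rfl⟩ := hσ a
    obtain ⟨l, rfl⟩ := hσ b
    exact (((Commute.refl σ).zpow_zpow j l).eq)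
  have hnormal : (layerGroup p σ i).Normal :=
    ⟨fun a ha b => by rwa [hcomm b a, mul_inv_cancel_right]⟩
  have htriv : ∀ τ ∈ layerGroup p σ i, ∀ w ∈ W, galRep p τ w = w := by
    intro τ hτ w hw
    refine (forall_zpowers_galRep_eq_iff (σ ^ p ^ i) w).2 ?_ τ hτ
    rw [← augGen_pow]
    exact hkill w hw
  refine ⟨hnormal, htriv, ?_⟩
  let _ := quotientModule p (layerGroup p σ i) W htriv
  obtain ⟨S, hS, hSW, hC⟩ := hW
  have hfin : Module.finrank (ZMod p) (MonoidAlgebra (ZMod p) ((K ≃ₐ[F] K) ⧸ layerGroup p σ i)) =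
      p ^ i := by
    rw [Module.finrank_eq_nat_card_basis (MonoidAlgebra.basis _ (ZMod p))]
    exact index_layerGroup hσ hcard hi
  have hrank : Module.rank (ZMod p) (socle (ZMod p) (augGen p σ) W) = Cardinal.mk S := by
    rw [← hSW]
    refine rank_socle_of_cyclics (d := p ^ i - 1) (adjoin_augGen hσ)
      ⟨_, augGen_pow_eq_zero hcard⟩ hS fun C hCS => ⟨(hC C hCS).1, ?_⟩
    rw [(hC C hCS).2, Nat.sub_add_cancel (pow_pos hp i)]
  rw [hrank]
  refine free_of_cyclics (B := MonoidAlgebra (ZMod p) ((K ≃ₐ[F] K) ⧸ layerGroup p σ i))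
    (MonoidAlgebra.mapDomainAlgHom (ZMod p) (ZMod p) (QuotientGroup.mk' (layerGroup p σ i)))
    ?_ ?_ (by rw [hfin]; exact pow_pos hp i) hS hSW (by rwa [hfin])
  · intro b
    induction b using MonoidAlgebra.induction_on with
    | of τ =>
      obtain ⟨τ, rfl⟩ := QuotientGroup.mk_surjective τ
      exact ⟨MonoidAlgebra.of _ _ τ, by simp⟩
    | add a b ha hb =>
      obtain ⟨a, rfl⟩ := ha
      obtain ⟨b, rfl⟩ := hb
      exact ⟨a + b, map_add _ _ _⟩
    | smul r a ha =>
      obtain ⟨a, rfl⟩ := ha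
      exact ⟨r • a, map_smul _ _ _⟩
  · intro a w
    have hsmul : ∀ (b : MonoidAlgebra (ZMod p) ((K ≃ₐ[F] K) ⧸ layerGroup p σ i)) (w : W),
        b • w = (quotientRep p (layerGroup p σ i) W htriv).asAlgebraHom b w := fun _ _ => rfl
    rw [hsmul]
    induction a using MonoidAlgebra.induction_on with
    | of τ =>
      have h1 : MonoidAlgebra.mapDomainAlgHom (ZMod p) (ZMod p)
          (QuotientGroup.mk' (layerGroup p σ i)) (MonoidAlgebra.of (ZMod p) _ τ) =
          MonoidAlgebra.of (ZMod p) _ (QuotientGroup.mk τ) := by simp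
      rw [h1, Representation.asAlgebraHom_of, quotientRep_mk, of_smul]
    | add a b ha hb =>
      rw [map_add, map_add, LinearMap.add_apply, Submodule.coe_add, ha, hb, add_smul]
    | smul r a ha =>
      rw [map_smul, map_smul, LinearMap.smul_apply, Submodule.coe_smul_of_tower, ha, smul_assoc]

end FreeQuotient

/-! ### Condition 3 in terms of annihilators -/

section LayerDecomposition

variable {p n : ℕ} [Fact p.Prime] {F : Type u} {K : Type v} [Field F] [Field K] [Algebra F K]
  {σ : K ≃ₐ[F] K} {δ : Kˣ}
  {W : Submodule (MonoidAlgebra (ZMod p) (K ≃ₐ[F] K)) (J p K)}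

/-- Brings both cases of condition 3 to one form: the elements of tX + W killed by t^(p^i).
Directness splits the annihilation condition between the summands. -/
theorem mem_map_sup_fixedPart_iff {i : ℕ} {T : Submodule (ZMod p) (J p K)}
    (hT : ∀ x, x ∈ T ↔
      ∃ ξ ∈ cyclicPart p F δ, augGen p σ • ξ = x ∧ augGen p σ ^ p ^ i • augGen p σ • ξ = 0)
    (hW : Disjoint (cyclicPart p F δ) W) (x : J p K) :
    x ∈ T ⊔ fixedPart p (layerGroup p σ i) W ↔
      (∃ ξ ∈ cyclicPart p F δ, ∃ y ∈ W, x = augGen p σ • ξ + y) ∧ augGen p σ ^ p ^ i • x = 0 := by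
  constructor
  · intro hx
    obtain ⟨a, ha, y, hy, rfl⟩ := Submodule.mem_sup.1 hx
    obtain ⟨ξ, hξ, rfl, h0⟩ := (hT a).1 ha
    obtain ⟨hyW, hy0⟩ := mem_fixedPart_layerGroup_iff.1 hy
    exact ⟨⟨ξ, hξ, y, hyW, rfl⟩, by rw [smul_add, h0, hy0, add_zero]⟩
  · rintro ⟨⟨ξ, hξ, y, hy, rfl⟩, h0⟩
    have h1 : augGen p σ ^ p ^ i • augGen p σ • ξ = 0 := by
      rw [smul_add] at h0
      refine Submodule.disjoint_def.1 hW _ (Submodule.smul_mem _ _ (Submodule.smul_mem _ _ hξ)) ?_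
      rw [eq_neg_of_add_eq_zero_left h0]
      exact Submodule.neg_mem _ (Submodule.smul_mem _ _ hy)
    rw [smul_add, h1, zero_add] at h0
    exact Submodule.add_mem_sup ((hT _).2 ⟨ξ, hξ, rfl, h1⟩) (mem_fixedPart_layerGroup_iff.2 ⟨hy, h0⟩)

variable {U : ℕ → Submodule (MonoidAlgebra (ZMod p) (K ≃ₐ[F] K)) (J p K)} {μ : ℕ}
  (h : NormFiltration (ZMod p) (augGen p σ) p n U (cls p δ) μ)

include h

theorem mem_map_sub_one_iff {i : ℕ} (hi : μ ≤ i + 1) (x : J p K) :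
    x ∈ Submodule.map (galRep p σ - 1) ((cyclicPart p F δ).restrictScalars (ZMod p)) ↔
      ∃ ξ ∈ cyclicPart p F δ, augGen p σ • ξ = x ∧ augGen p σ ^ p ^ i • augGen p σ • ξ = 0 := by
  constructor
  · rintro ⟨ξ, hξ, rfl⟩
    refine ⟨ξ, hξ, (galRep_sub_one_apply σ ξ).symm, ?_⟩
    rw [smul_smul, ← pow_succ]
    exact pow_smul_eq_zero_of_le (Nat.succ_le_succ (h.shiftedPow_le_pow hi))
      (h.isUniform_span_generator.1 ξ hξ)
  · rintro ⟨ξ, hξ, rfl, -⟩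
    exact ⟨ξ, hξ, galRep_sub_one_apply σ ξ⟩

/-- The operator is t · t^(p^k - p^i), and X is uniform of length p^k + 1, so its image is exactly
the part of tX killed by t^(p^i). -/
theorem mem_map_sub_one_mul_pow_iff {i k : ℕ} (hμ : μ = k + 1) (hi : i < k) (x : J p K) :
    x ∈ Submodule.map ((galRep p σ - 1) * (galRep p (σ ^ p ^ i) - 1) ^ (p ^ (k - i) - 1))
        ((cyclicPart p F δ).restrictScalars (ZMod p)) ↔
      ∃ ξ ∈ cyclicPart p F δ, augGen p σ • ξ = x ∧ augGen p σ ^ p ^ i • augGen p σ • ξ = 0 := by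
  have hact : ∀ ξ : J p K, ((galRep p σ - 1) * (galRep p (σ ^ p ^ i) - 1) ^ (p ^ (k - i) - 1)) ξ =
      augGen p σ • augGen p σ ^ (p ^ k - p ^ i) • ξ := by
    intro ξ
    rw [Module.End.mul_apply, galRep_sub_one_apply, galRep_sub_one_pow_apply, ← augGen_pow,
      ← pow_mul, Nat.mul_sub, ← pow_add, Nat.add_sub_cancel' hi.le, mul_one]
  have hle := h.pow_mono hi.le
  have hs : shiftedPow p μ = p ^ k := by rw [hμ]; rfl
  have hunif := h.isUniform_span_generator
  rw [hs] at hunif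
  constructor
  · rintro ⟨ξ, hξ, rfl⟩
    refine ⟨_, Submodule.smul_mem _ (augGen p σ ^ (p ^ k - p ^ i)) hξ, (hact ξ).symm, ?_⟩
    rw [smul_smul, smul_smul, ← pow_succ, ← pow_add,
      show p ^ i + 1 + (p ^ k - p ^ i) = p ^ k + 1 by omega]
    exact hunif.1 ξ hξ
  · rintro ⟨ξ, hξ, rfl, h0⟩
    obtain ⟨ζ, hζ, rfl⟩ := hunif.exists_of_pow_smul_eq_zero (a := p ^ i + 1) (by omega) hξ
      (by rw [pow_succ, mul_smul, h0])
    refine ⟨ζ, hζ, ?_⟩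
    rw [hact, show p ^ k + 1 - (p ^ i + 1) = p ^ k - p ^ i by omega]

end LayerDecomposition

/-! ### From the abstract filtration to the theorem -/

section Main

variable {p n : ℕ} [Fact p.Prime] {F : Type u} {K : Type v} [Field F] [Field K] [Algebra F K]
  [FiniteDimensional F K] {σ : K ≃ₐ[F] K}
  {hσ : ∀ τ : K ≃ₐ[F] K, τ ∈ Subgroup.zpowers σ} {m : WithBot ℕ} {δ : Kˣ}
  (h : NormFiltration (ZMod p) (augGen p σ) p n (layerSubmodule p hσ) (cls p δ) (succIndex m))

include h

theorem exists_isDecomposition :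
    ∃ Y : Fin (n + 1) → Submodule (MonoidAlgebra (ZMod p) (K ≃ₐ[F] K)) (J p K),
      IsDecomposition p n σ m δ Y := by
  obtain ⟨Y, hcompl, hind, hS, hU⟩ := h.exists_decomposition
  refine ⟨Y, hcompl, hind, ?_, hS, ?_, ?_⟩
  · rw [← shiftedPow_succIndex]
    exact finrank_span_singleton_of_pow_smul h.adjoin h.pow_smul_generator
      h.pow_smul_generator_ne_zero
  · intro i hi hmi
    ext x
    exact (hU i hi x).trans (mem_map_sup_fixedPart_iff
      (mem_map_sub_one_iff h (succIndex_le_succ_iff.2 hmi)) hcompl.disjoint x).symm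
  · rintro i k hi rfl hik
    ext x
    exact (hU i hi x).trans (mem_map_sup_fixedPart_iff
      (mem_map_sub_one_mul_pow_iff h rfl hik) hcompl.disjoint x).symm

variable {Y : Fin (n + 1) → Submodule (MonoidAlgebra (ZMod p) (K ≃ₐ[F] K)) (J p K)}
  (hY : IsDecomposition p n σ m δ Y)

include hY

theorem IsDecomposition.mem_layerSubmodule_iff {i : ℕ} (hi : i < n) (x : J p K) :
    x ∈ layerSubmodule p hσ i ↔ (∃ ξ ∈ Submodule.span
      (MonoidAlgebra (ZMod p) (K ≃ₐ[F] K)) {cls p δ}, ∃ y ∈ ⨆ i, Y i,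
      x = augGen p σ • ξ + y) ∧ augGen p σ ^ p ^ i • x = 0 := by
  change x ∈ layerClasses p σ i ↔ _
  by_cases hmi : m ≤ (i : WithBot ℕ)
  · rw [hY.layer_eq_of_le i hi hmi]
    exact mem_map_sup_fixedPart_iff (mem_map_sub_one_iff h (succIndex_le_succ_iff.2 hmi))
      hY.isCompl.disjoint x
  · induction m using WithBot.recBotCoe with
    | bot => exact absurd bot_le hmi
    | coe k =>
      have hik : i < k := lt_of_not_ge fun hki => hmi (WithBot.coe_le_coe.2 hki)
      rw [hY.layer_eq_of_lt i k hi rfl hik]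
      exact mem_map_sup_fixedPart_iff (mem_map_sub_one_mul_pow_iff h rfl hik)
        hY.isCompl.disjoint x

theorem IsDecomposition.isUniform (i : Fin (n + 1)) :
    IsUniform (augGen p σ) (p ^ (i : ℕ)) (Y i) := by
  obtain ⟨S, hS, hSY, hC⟩ := hY.isSumOfCyclics i
  rw [← hSY, sSup_eq_iSup']
  refine IsUniform.iSup ((sSupIndep_iff S).1 hS) fun C => ?_
  obtain ⟨⟨x, hx⟩, hrank⟩ := hC C C.2
  have h1 := h.one_le_pow i
  rw [hx] at hrank ⊢
  obtain ⟨h2, h3⟩ := pow_smul_of_finrank_span_singleton (l := p ^ (i : ℕ) - 1) h.adjoin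
    h.isNilpotent (by rw [hrank]; omega)
  have := isUniform_span_singleton h.adjoin h2 h3
  rwa [Nat.sub_add_cancel h1] at this

end Main

end PthPower

theorem corollary2 {F : Type*} {K : Type*} [Field F] [Field K] [Algebra F K]
    [FiniteDimensional F K] [IsGalois F K]
    (p n : ℕ) [Fact p.Prime] (hn : 1 ≤ n)
    (σ : K ≃ₐ[F] K) (hσ : ∀ τ : K ≃ₐ[F] K, τ ∈ Subgroup.zpowers σ)
    (hcard : Nat.card (K ≃ₐ[F] K) = p ^ n)
    (hξ : ∃ ξ : F, IsPrimitiveRoot ξ p)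
    (hp2 : p = 2 → 1 < n ∨ ∃ k : K, Algebra.norm F k = -1)
    (m : WithBot ℕ) (hm : IsLeast (PthPower.exceptionalIndices p n σ) m)
    (δ : Kˣ) (hδ : PthPower.IsExceptionalAt p σ m δ) :
    (∃ Y : Fin (n + 1) →
        Submodule (MonoidAlgebra (ZMod p) (K ≃ₐ[F] K)) (PthPower.J p K),
      PthPower.IsDecomposition p n σ m δ Y) ∧
    ∀ Y : Fin (n + 1) →
        Submodule (MonoidAlgebra (ZMod p) (K ≃ₐ[F] K)) (PthPower.J p K),
      PthPower.IsDecomposition p n σ m δ Y →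
      (∀ i : Fin (n + 1), m < ((i : ℕ) : WithBot ℕ) →
        PthPower.normClasses p σ i = PthPower.fixedPart p ⊤ (⨆ j ≥ i, Y j)) ∧
      (∀ i : Fin (n + 1), ((i : ℕ) : WithBot ℕ) ≤ m →
        PthPower.normClasses p σ i =
          PthPower.fixedPart p ⊤ (PthPower.cyclicPart p F δ ⊔ ⨆ j ≥ i, Y j)) ∧
      (∀ i : Fin (n + 1), ((i : ℕ) : WithBot ℕ) ≠ m →
        PthPower.HasFreeRank p (PthPower.layerGroup p σ i) (Y i)
          (PthPower.normDim p n σ i)) ∧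
      (∀ i : Fin (n + 1), ((i : ℕ) : WithBot ℕ) = m →
        ∃ r : Cardinal,
          PthPower.HasFreeRank p (PthPower.layerGroup p σ i) (Y i) r ∧
            1 + r = PthPower.normDim p n σ i) := by
  have h := PthPower.normFiltration hσ hcard hn hξ hp2 hm hδ
  refine ⟨PthPower.exists_isDecomposition h, fun Y hY => ?_⟩
  have hU := fun i (hi : i < n) => PthPower.IsDecomposition.mem_layerSubmodule_iff h hY hi
  have hunif := PthPower.IsDecomposition.isUniform h hY
  have hnorm : ∀ i ≤ n, PthPower.normClasses p σ i = PthPower.normImage (ZMod p)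
      (PthPower.augGen p σ) p i (PthPower.layerSubmodule p hσ i) :=
    fun i hi => PthPower.normClasses_eq_normImage hσ hcard hi
  have hfree := fun i : Fin (n + 1) => PthPower.hasFreeRank_of_isSumOfCyclics hσ hcard
    (Nat.lt_succ_iff.1 i.2) (hY.isSumOfCyclics i) (hunif i).1
  refine ⟨fun i hi => ?_, fun i hi => ?_, fun i hi => ?_, fun i hi => ?_⟩
  · have hμ : PthPower.succIndex m ≤ i := not_lt.1 fun hlt =>
      not_le.2 hi (PthPower.lt_succIndex_iff.1 hlt)
    ext x
    rw [hnorm i (Nat.lt_succ_iff.1 i.2), h.mem_normImage_iff hY.isCompl hY.indep hunif hU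
      (Nat.lt_succ_iff.1 i.2), PthPower.mem_fixedPart_top_iff hσ]
    constructor
    · rintro ⟨ξ, -, y, hy, rfl, -, hty, hξ0⟩
      rw [hξ0 hμ, zero_add]
      exact ⟨hy, hty⟩
    · rintro ⟨hx, htx⟩
      exact ⟨0, Submodule.zero_mem _, x, hx, by simp, by simp, htx, fun _ => rfl⟩
  · have hμ : (i : ℕ) < PthPower.succIndex m := PthPower.lt_succIndex_iff.2 hi
    ext x
    rw [hnorm i (Nat.lt_succ_iff.1 i.2), h.mem_normImage_iff hY.isCompl hY.indep hunif hU
      (Nat.lt_succ_iff.1 i.2), PthPower.mem_fixedPart_top_iff hσ]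
    constructor
    · rintro ⟨ξ, hξ, y, hy, rfl, htξ, hty, -⟩
      exact ⟨Submodule.add_mem_sup hξ hy, by rw [smul_add, htξ, hty, add_zero]⟩
    · rintro ⟨hx, htx⟩
      obtain ⟨ξ, hξ, y, hy, rfl⟩ := Submodule.mem_sup.1 hx
      have hy' : y ∈ ⨆ j, Y j := (iSup_mono fun j => iSup_le fun _ => le_rfl :
        (⨆ j ≥ i, Y j) ≤ ⨆ j, Y j) hy
      rw [smul_add] at htx
      have htξ : PthPower.augGen p σ • ξ = 0 := by
        refine Submodule.disjoint_def.1 hY.isCompl.disjoint _ (Submodule.smul_mem _ _ hξ) ?_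
        rw [eq_neg_of_add_eq_zero_left htx]
        exact Submodule.neg_mem _ (Submodule.smul_mem _ _ hy')
      rw [htξ, zero_add] at htx
      exact ⟨ξ, hξ, y, hy, rfl, htξ, htx, fun hμ' => absurd hμ' (not_le.2 hμ)⟩
  · have heq : PthPower.normDim p n σ i = Module.rank (ZMod p)
        (PthPower.socle (ZMod p) (PthPower.augGen p σ) (Y i)) := by
      rw [PthPower.normDim]
      split_ifs with hin
      · rw [hnorm i hin.le, hnorm (i + 1) hin]
        exact h.rank_normImage_quotient_of_ne hY.isCompl hY.indep hunif hU hin fun hμ =>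
          hi (PthPower.succIndex_eq_succ_iff.1 hμ)
      · have hlast : i = Fin.last n := Fin.ext (le_antisymm (Nat.lt_succ_iff.1 i.2) (not_lt.1 hin))
        rw [hnorm n le_rfl, h.normImage_top_eq hY.isCompl hY.indep hunif hU, hlast]
    rw [heq]
    exact hfree i
  · have hμ := PthPower.succIndex_eq_succ_iff.2 hi
    -- The index m is never n, so e_m is always the dimension of a quotient.
    have hin : (i : ℕ) < n := by
      have := h.le
      omega
    refine ⟨_, hfree i, ?_⟩
    rw [PthPower.normDim, if_pos hin, hnorm i hin.le, hnorm (i + 1) hin]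
    exact (h.rank_normImage_quotient_of_eq hY.isCompl hY.indep hunif hU hin hμ).symm
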